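/- Let $C\subset\mathbf P^2$ be a cuspidal cubic curve over $\mathbf C$ with smooth part $C_{reg}$. Choose linear coordinates in which $C_{reg}=\{y=x^3\}$, and let $\kappa:C_{reg}\to\mathbf C$, $\kappa(x,x^3)=x$ (these coordinates are unique up to linear automorphisms of $\mathbf P^2$ preserving $C$, which act by $\kappa\mapsto c\,\kappa$, $c\in\mathbf C^*$). A quadratic transformation $f$ is a birational self-map of $\mathbf P^2$ given by three quadratic forms without common factor. Its points of indeterminacy $I(f)=\{p_1^+,p_2^+,p_3^+\}$ and those of its inverse $I(f^{-1})=\{p_1^-,p_2^-,p_3^-\}$ are counted with multiplicity, infinitely near points being identified with the points of $\mathbf P^2$ under them, and are indexed compatibly: if the $p_j^+$ are distinct, $p_k^-$ is the image of the line through the two points $p_j^+$, $j\ne k$; if $p_i^+=p_j^+\neq p_k^+$, then $p_k^-$ is the image of the exceptional line through $p_i^+$ not containing $p_k^+$, and $p_i^-=p_j^-$ is the image of the line joining $p_i^+$ and $p_k^+$; if $p_1^+=p_2^+=p_3^+$, then $p_1^-=p_2^-=p_3^-$ is the image of the only exceptional line. We say that $f$ properly fixes $C$ if $\overline{f(C\setminus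 I(f))}=C$ and all points of $I(f)\cap C$ and of $I(f^{-1})\cap C$ are regular points of $C$. Then $f$ restricts to an automorphism $f|_{C_{reg}}$ of $C_{reg}$ of the form $\kappa(f|_{C_{reg}}(p))=a\,\kappa(p)+b$, and $a$ is called the multiplier of $f|_{C_{reg}}$. Orbit data consist of integers $n_1,n_2,n_3\ge 1$ and a permutation $\sigma$ of $\{1,2,3\}$. The characteristic polynomial $P$ of the orbit data is that of the linear map $\hat f^*=S\circ Q$ on the space with basis $H$, $E_{i,m}$ ($1\le i\le 3$, $0\le m\le n_i-1$), where $$Q(H)=2H-\sum_j E_{j,0},\quad Q(E_{i,0})=H-\sum_{j\ne i}E_{j,0},\quad Q(E_{i,m})=E_{i,m}\ (m>0),$$ $$S(H)=H,\quad S(E_{\sigma_i,0})=E_{i,n_i-1},\quad S(E_{i,m})=E_{i,m-1}\ (1\le m\le n_i-1).$$ A quadratic transformation $f$ properly fixing $C$ (with a compatible indexing as above) tentatively realizes the orbit data if $p_j^-\in C_{reg}$ and $(f|_{C_{reg}})^{n_j-1}(p_j^-)=p_{\sigma_j}^+$ for $j=1,2,3$. Theorem. Let $C$ be a cuspidal cubic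 and let $n_1,n_2,n_3\ge1$, $\sigma$ be orbit data. (1) If a quadratic transformation $f$ properly fixes $C$ and tentatively realizes the orbit data, then the multiplier of $f|_{C_{reg}}$ is a root of $P$. (2) Conversely, let $a\in\mathbf C$ be a root of $P$ that is not a root of unity. Then there is a quadratic transformation $f$ properly fixing $C$ that tentatively realizes the orbit data and has multiplier $a$. Any two such transformations are conjugate by a linear automorphism $T$ of $\mathbf P^2$ with $T(C)=C$. (3) In the situation of (2), $f|_{C_{reg}}$ has a unique fixed point $p_0$, the coordinates can be chosen such that $\kappa(p_0)=\frac13$, and for every such choice the numbers $\tilde p_j^-:=\kappa(p_j^-)-\kappa(p_0)$ are as follows. If $\sigma_j=j$, then $$\tilde p_j^-=\frac{a-1}{1-a^{n_j}}.$$ If $\sigma$ swaps $j$ and $k\neq j$, then $$\tilde p_j^-=\frac{(a-1)(1+a^{n_k})}{1-a^{n_j+n_k}}.$$ If $\sigma$ is the cycle $j\mapsto k\mapsto l\mapsto j$, then $$\tilde p_j^-=\frac{(a-1)(1+a^{n_l}+a^{n_k+n_l})}{1-a^{n_1+n_2+n_3}}.$$ -/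

import Mathlib

namespace CuspCubic

/-- Homogeneous coordinate vectors. -/
abbrev Vec : Type := Fin 3 → ℂ

/-- The complex projective plane. -/
abbrev P2 : Type := Projectivization ℂ Vec

/-- Ternary forms live in this polynomial ring. -/
abbrev Poly : Type := MvPolynomial (Fin 3) ℂ

/-- The value at `v` of a triple of polynomials. -/
noncomputable def evalTriple (A : Fin 3 → Poly) (v : Vec) : Vec :=
  fun i => MvPolynomial.eval v (A i)

/-- A linear automorphism of the plane, acting on points. -/
noncomputable def act (T : Vec ≃ₗ[ℂ] Vec) : P2 → P2 :=
  Projectivization.map T.toLinearMap T.injective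

/-! ### Plane cubics -/

/-- The plane curve `{c = 0}`. -/
def curve (c : Poly) : Set P2 := {p | MvPolynomial.eval p.rep c = 0}

/-- The regular points of the curve `{c = 0}`. -/
def regPts (c : Poly) : Set P2 :=
  {p | p ∈ curve c ∧ ∃ i, MvPolynomial.eval p.rep (MvPolynomial.pderiv i c) ≠ 0}

/-- The matrix of second partial derivatives of `c` at `v`. -/
noncomputable def hessian (c : Poly) (v : Vec) : Matrix (Fin 3) (Fin 3) ℂ :=
  Matrix.of fun i j =>
    MvPolynomial.eval v (MvPolynomial.pderiv i (MvPolynomial.pderiv j c))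

/-- `c` is the equation of an irreducible plane cubic with a cusp, that is, with a singular point
at which the quadratic part of the equation is a nonzero square (the two tangent lines
coincide). -/
def IsCuspidalCubic (c : Poly) : Prop :=
  c.IsHomogeneous 3 ∧ Irreducible c ∧
    ∃ p : P2, (∀ i, MvPolynomial.eval p.rep (MvPolynomial.pderiv i c) = 0) ∧
      (hessian c p.rep).rank = 1

/-- The Zariski closure of a subset of the plane. -/
def zariskiClosure (S : Set P2) : Set P2 :=
  {p | ∀ (d : ℕ) (h : Poly), h.IsHomogeneous d →
    (∀ q ∈ S, MvPolynomial.eval q.rep h = 0) → MvPolynomial.eval p.rep h = 0}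

/-- The point `[t : t³ : 1]`. -/
noncomputable def cuspPoint (t : ℂ) : P2 :=
  Projectivization.mk ℂ (![t, t ^ 3, 1] : Vec) (fun h => by simpa using congrFun h 2)

/-- The point with parameter `t` in the linear coordinates given by `M`. -/
noncomputable def param (M : Vec ≃ₗ[ℂ] Vec) (t : ℂ) : P2 := act M (cuspPoint t)

/-- In the linear coordinates given by `M` the smooth part of the curve is `{y = x³}`. The
identification `κ : C_reg → Pic⁰(C) ≅ ℂ` is then the inverse of `t ↦ param M t`. -/
def IsAdapted (c : Poly) (M : Vec ≃ₗ[ℂ] Vec) : Prop :=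
  Set.range (param M) = regPts c

/-! ### Quadratic transformations -/

/-- A quadratic Cremona transformation of the plane: a birational map which is given by three
quadratic forms without common factor. Its inverse `bwd` is again given by such a triple. -/
structure QuadraticTransformation where
  /-- the forms defining the map -/
  fwd : Fin 3 → Poly
  /-- the forms defining the inverse map -/
  bwd : Fin 3 → Poly
  fwd_hom : ∀ i, (fwd i).IsHomogeneous 2
  bwd_hom : ∀ i, (bwd i).IsHomogeneous 2
  fwd_prim : ∀ d : Poly, (∀ i, d ∣ fwd i) → IsUnit d
  bwd_prim : ∀ d : Poly, (∀ i, d ∣ bwd i) → IsUnit d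
  bwd_fwd : ∃ e : Poly, e ≠ 0 ∧
    ∀ i, MvPolynomial.bind₁ fwd (bwd i) = e * MvPolynomial.X i
  fwd_bwd : ∃ e : Poly, e ≠ 0 ∧
    ∀ i, MvPolynomial.bind₁ bwd (fwd i) = e * MvPolynomial.X i

namespace QuadraticTransformation

/-- The set `I(f)` of points of indeterminacy, as a set of points of the plane. -/
def indet (f : QuadraticTransformation) : Set P2 := {p | evalTriple f.fwd p.rep = 0}

/-- The set `I(f⁻¹)`. -/
def indetInv (f : QuadraticTransformation) : Set P2 := {p | evalTriple f.bwd p.rep = 0}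

/-- `f` is defined at `p` and `f(p) = q`. -/
def Maps (f : QuadraticTransformation) (p q : P2) : Prop :=
  p ∉ f.indet ∧ ∃ s : ℂ, evalTriple f.fwd p.rep = s • q.rep

/-- The proper transform of a set `S`, the closure of `f(S ∖ I(f))`. -/
def properTransform (f : QuadraticTransformation) (S : Set P2) : Set P2 :=
  zariskiClosure {q | ∃ p ∈ S, f.Maps p q}

/-- `{ℓ = 0}` is an exceptional line of `f`, contracted to the point `r`. -/
def Contracts (f : QuadraticTransformation) (ℓ : Module.Dual ℂ Vec) (r : P2) : Prop :=
  ℓ ≠ 0 ∧ ∀ v, ℓ v = 0 → ∃ s : ℂ, evalTriple f.fwd v = s • r.rep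

/-- `p⁺` and `p⁻` are compatible indexings by `{1,2,3}` of the points of indeterminacy of `f`
and of `f⁻¹`, all considered as points of the plane (an infinitely near point is identified with
the point under it).  In the generic case the three `p⁺ⱼ` are distinct and `p⁻ₖ` is the image of
the line through the other two.  In the generic degenerate case `p⁺ⱼ` is infinitely near to
`p⁺ᵢ`, the line joining `p⁺ᵢ` and `p⁺ₖ` is contracted to `p⁻ⱼ`, a second exceptional line through
`p⁺ᵢ` is contracted to `p⁻ₖ`, and `p⁻ⱼ` is infinitely near to `p⁻ᵢ`.  In the last case there is
only one point of indeterminacy and one exceptional line. -/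
def IsIndexing (f : QuadraticTransformation) (pPlus pMinus : Fin 3 → P2) : Prop :=
  f.indet = Set.range pPlus ∧ f.indetInv = Set.range pMinus ∧
  ((Function.Injective pPlus ∧
      ∀ k, ∃ ℓ, (∀ j, j ≠ k → ℓ (pPlus j).rep = 0) ∧ f.Contracts ℓ (pMinus k)) ∨
   (∃ i j k : Fin 3, i ≠ j ∧ j ≠ k ∧ i ≠ k ∧
      pPlus i = pPlus j ∧ pPlus i ≠ pPlus k ∧ pMinus i = pMinus j ∧
      (∃ ℓ, ℓ (pPlus i).rep = 0 ∧ ℓ (pPlus k).rep = 0 ∧ f.Contracts ℓ (pMinus j)) ∧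
      (∃ ℓ, ℓ (pPlus i).rep = 0 ∧ ℓ (pPlus k).rep ≠ 0 ∧ f.Contracts ℓ (pMinus k))) ∨
   ((∀ i j, pPlus i = pPlus j) ∧ (∀ i j, pMinus i = pMinus j) ∧
      ∃ ℓ, ℓ (pPlus 0).rep = 0 ∧ f.Contracts ℓ (pMinus 0)))

/-- `f` properly fixes the curve `{c = 0}`: the proper transform of the curve is the curve itself,
and the points of `I(f)` and of `I(f⁻¹)` on the curve are regular points of it. -/
structure ProperlyFixes (f : QuadraticTransformation) (c : Poly) : Prop where
  fixes : f.properTransform (curve c) = curve c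
  indet_reg : ∀ p ∈ curve c, p ∈ f.indet → p ∈ regPts c
  indetInv_reg : ∀ p ∈ curve c, p ∈ f.indetInv → p ∈ regPts c

/-- `τ` is the restriction `f|_{C_reg}`: the regular self-map of the smooth part of the curve that
agrees with `f` wherever `f` is defined. -/
structure IsRestriction (f : QuadraticTransformation) (c : Poly)
    (τ : regPts c → regPts c) : Prop where
  agrees : ∀ p : regPts c, (p : P2) ∉ f.indet → f.Maps p (τ p)
  regular : ∀ p : regPts c, ∃ (d : ℕ) (A : Fin 3 → Poly), (∀ i, (A i).IsHomogeneous d) ∧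
    evalTriple A (p : P2).rep ≠ 0 ∧
    ∀ q : regPts c, evalTriple A (q : P2).rep ≠ 0 →
      ∃ s : ℂ, evalTriple A (q : P2).rep = s • (τ q : P2).rep

/-- `f|_{C_reg}` is `t ↦ a t + b` in the coordinate on the smooth part of the curve that is
given by `M`. -/
def ActsBy (f : QuadraticTransformation) (c : Poly) (M : Vec ≃ₗ[ℂ] Vec) (a b : ℂ) : Prop :=
  ∃ τ, f.IsRestriction c τ ∧
    ∀ (p : regPts c) (t : ℂ), (p : P2) = param M t → (τ p : P2) = param M (a * t + b)

/-- `a` is the multiplier of `f|_{C_reg}`. -/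
def HasMultiplier (f : QuadraticTransformation) (c : Poly) (a : ℂ) : Prop :=
  ∃ M, IsAdapted c M ∧ ∃ b, f.ActsBy c M a b

/-- `f` properly fixes the curve `{c = 0}` and, with the given indexing of its points of
indeterminacy, tentatively realizes the orbit data `n, σ`. -/
structure TentativelyRealizes (f : QuadraticTransformation) (c : Poly)
    (n : Fin 3 → ℕ) (σ : Equiv.Perm (Fin 3)) (pPlus pMinus : Fin 3 → P2) : Prop where
  properlyFixes : f.ProperlyFixes c
  indexing : f.IsIndexing pPlus pMinus
  orbits : ∃ τ, f.IsRestriction c τ ∧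
    ∀ j, ∃ x : regPts c, (x : P2) = pMinus j ∧ (τ^[n j - 1] x : P2) = pPlus (σ j)

/-- `g = T ∘ f ∘ T⁻¹` as rational maps, where `T` is linear and maps the curve `{c = 0}` onto
itself. -/
def ConjugateBy (f g : QuadraticTransformation) (c : Poly) (T : Vec ≃ₗ[ℂ] Vec) : Prop :=
  act T '' curve c = curve c ∧
    ∃ s : ℂ, s ≠ 0 ∧ ∀ v, evalTriple g.fwd (T v) = s • T (evalTriple f.fwd v)

end QuadraticTransformation

/-! ### The characteristic polynomial of orbit data -/

/-- The index set of the basis `H`, `E_{i,m}` (`0 ≤ m < n_i`). -/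
abbrev Idx (n : Fin 3 → ℕ) : Type := Option ((i : Fin 3) × Fin (n i))

/-- The basis vector `H`. -/
def vecH (n : Fin 3 → ℕ) : Idx n → ℤ := Pi.single none 1

/-- The basis vector `E_{i,m}`, for `m < n_i`. -/
def vecE (n : Fin 3 → ℕ) (i : Fin 3) (m : ℕ) : Idx n → ℤ :=
  if h : m < n i then Pi.single (some ⟨i, ⟨m, h⟩⟩) 1 else 0

/-- The map `Q`: `H ↦ 2H - ∑ E_{j,0}`, `E_{i,0} ↦ H - ∑_{j ≠ i} E_{j,0}`, and `E_{i,m} ↦ E_{i,m}`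
for `m > 0`. -/
def matQ (n : Fin 3 → ℕ) : Matrix (Idx n) (Idx n) ℤ :=
  Matrix.of fun row col =>
    (match col with
      | none => 2 • vecH n - ∑ j, vecE n j 0
      | some ⟨i, m⟩ =>
        if (m : ℕ) = 0 then vecH n - ∑ j ∈ Finset.univ.erase i, vecE n j 0
        else vecE n i m : Idx n → ℤ) row

/-- The map `S`: `H ↦ H`, `E_{σ i,0} ↦ E_{i,n_i-1}`, and `E_{i,m} ↦ E_{i,m-1}` for `m > 0`. -/
def matS (n : Fin 3 → ℕ) (σ : Equiv.Perm (Fin 3)) : Matrix (Idx n) (Idx n) ℤ :=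
  Matrix.of fun row col =>
    (match col with
      | none => vecH n
      | some ⟨i, m⟩ =>
        if (m : ℕ) = 0 then vecE n (σ.symm i) (n (σ.symm i) - 1)
        else vecE n i (m - 1) : Idx n → ℤ) row

/-- The characteristic polynomial `P` of the isometry `f̂^* = S ∘ Q` attached to the orbit data
`n, σ`. -/
noncomputable def charPoly (n : Fin 3 → ℕ) (σ : Equiv.Perm (Fin 3)) : Polynomial ℤ :=
  (matS n σ * matQ n).charpoly

/-! ### The explicit values -/

/-- The values of `κ(p⁻ⱼ) - κ(p₀)`, where `p₀` is the fixed point of `f|_{C_reg}`, normalized by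
`κ(p₀) = 1/3`; the three cases are those of an orbit of `σ` with one, two or three elements. -/
noncomputable def baseValue (n : Fin 3 → ℕ) (σ : Equiv.Perm (Fin 3)) (a : ℂ) (j : Fin 3) : ℂ :=
  if σ j = j then (a - 1) / (1 - a ^ n j)
  else if σ (σ j) = j then (a - 1) * (1 + a ^ n (σ j)) / (1 - a ^ (n j + n (σ j)))
  else (a - 1) * (1 + a ^ n (σ (σ j)) + a ^ (n (σ j) + n (σ (σ j)))) /
    (1 - a ^ (n j + n (σ j) + n (σ (σ j))))

end CuspCubic

namespace CuspCubic

open MvPolynomial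

/-! ### Ternary forms -/

/-! Put the cubic in the form `x³ = y z²`, with smooth part `(t, t³, 1)` and cusp `(0, 1, 0)`. The
six quadratic monomials restrict to the distinct powers `1, t, t², t³, t⁴, t⁶`. Hence a quadratic
form is determined by its restriction to the curve, and a polynomial of degree at most 6 is such a
restriction exactly when its `t⁵` coefficient vanishes.

If `f` properly fixes the curve, its restriction to the smooth part is polynomial, and the inverse
forces degree one, so it is `t ↦ a t + b`. On the curve `f` then reads `F(t) · (a t + b, (a t + b)³,
1)`. The cusp is not a point of indeterminacy, so `F` is a cubic; its roots `u₀, u₁, u₂` are the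
parameters of `I(f)`. The missing `t⁵` term in the second coordinate says `b = a (u₀ + u₁ + u₂) /
3`. Thus `a`, the roots and a scalar determine `f` (`exists_model`). The condition `u₀ + u₁ + u₂ ≠
0` is necessary, since otherwise the three points are collinear and their line divides all three
forms (`HasModel.sum_ne_zero`). It is also sufficient, because the model has an explicit inverse of
the same kind (`modelTriple_prim`, `modelTriple_inverse`).

The line through `u_j` and `u_m` meets the curve again at `-u_j - u_m`. It is therefore contracted
to the image of that point, giving `p⁻_i = a p⁺_i - 2 b` for every compatible indexing, degenerate
ones included (`HasModel.of_isIndexing`). Write `r_j` for the parameter of `p⁻_j`, and set `h = 3 b`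
and `x_j = (1 - a) r_j - b`. The orbit conditions become `x_{σ j} = a^{n_j} x_j + (a - 1) h`, and
summing the `r_j` gives `x₀ + x₁ + x₂ = (a - 2) h`. These are the equations of an eigenvector of `S
∘ Q` for the eigenvalue `a`, with coordinate `h` on `H` and `a^m x_j` on `E_{j,m}`
(`aeval_charPoly_eq_zero_iff`).

Since `h ≠ 0` for a realization, its multiplier is a root of `P`. Conversely, if `a` is not a root
of unity, going round the cycles of `σ` solves the recursion uniquely in terms of `h`
(`eq_baseValue`). So `h ≠ 0`, and the eigenvector supplies the parameters of a transformation
(`exists_tentativelyRealizes`). Rescaling the coordinate puts the fixed point at `1/3`; then every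
parameter is determined, which gives both the formulas and uniqueness up to linear conjugacy. -/

theorem ternaryForm_eq_sum {p : Poly} {n : ℕ} (hp : p.IsHomogeneous n) :
    p = ∑ d ∈ Finset.Nat.antidiagonalTuple 3 n,
      C (coeff (Finsupp.equivFunOnFinite.symm d) p) * (X 0 ^ d 0 * X 1 ^ d 1 * X 2 ^ d 2) := by
  have hmon : ∀ d : Fin 3 → ℕ, ∀ r : ℂ,
      C r * (X 0 ^ d 0 * X 1 ^ d 1 * X 2 ^ d 2 : Poly) =
        monomial (Finsupp.equivFunOnFinite.symm d) r := by
    intro d r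
    rw [monomial_eq, Finsupp.prod_fintype _ _ (fun i => pow_zero _)]
    simp [Fin.prod_univ_three]
  simp only [hmon]
  ext e
  rw [coeff_sum]
  simp only [coeff_monomial]
  by_cases he : Finsupp.degree e = n
  · rw [Finset.sum_eq_single (⇑e)]
    · simp
    · intro d _ hd
      rw [if_neg]
      rintro rfl
      exact hd rfl
    · intro h
      exact absurd (Finset.Nat.mem_antidiagonalTuple.2
        (by rw [← he, Finsupp.degree_eq_sum])) h
  · rw [hp.coeff_eq_zero he]
    refine (Finset.sum_eq_zero fun d _ => ?_).symm
    split_ifs with h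
    · rw [h, hp.coeff_eq_zero he]
    · rfl

/-- The ternary quadratic form with the given coefficients. -/
noncomputable def conicForm (q : Fin 6 → ℂ) : Poly :=
  C (q 0) * X 0 ^ 2 + C (q 1) * (X 0 * X 1) + C (q 2) * (X 0 * X 2) + C (q 3) * X 1 ^ 2 +
    C (q 4) * (X 1 * X 2) + C (q 5) * X 2 ^ 2

/-- The ternary cubic form with the given coefficients. -/
noncomputable def cubicForm (q : Fin 10 → ℂ) : Poly :=
  C (q 0) * X 0 ^ 3 + C (q 1) * (X 0 ^ 2 * X 1) + C (q 2) * (X 0 ^ 2 * X 2) +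
    C (q 3) * (X 0 * X 1 ^ 2) + C (q 4) * (X 0 * X 1 * X 2) + C (q 5) * (X 0 * X 2 ^ 2) +
    C (q 6) * X 1 ^ 3 + C (q 7) * (X 1 ^ 2 * X 2) + C (q 8) * (X 1 * X 2 ^ 2) +
    C (q 9) * X 2 ^ 3

theorem exists_eq_conicForm {p : Poly} (hp : p.IsHomogeneous 2) : ∃ q, p = conicForm q := by
  have h := ternaryForm_eq_sum hp
  have hd : Finset.Nat.antidiagonalTuple 3 2 =
      {![2, 0, 0], ![1, 1, 0], ![1, 0, 1], ![0, 2, 0], ![0, 1, 1], ![0, 0, 2]} := by decide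
  rw [hd, Finset.sum_insert (by decide), Finset.sum_insert (by decide),
    Finset.sum_insert (by decide), Finset.sum_insert (by decide), Finset.sum_insert (by decide),
    Finset.sum_singleton] at h
  refine ⟨fun k => coeff (Finsupp.equivFunOnFinite.symm ((![![2, 0, 0], ![1, 1, 0], ![1, 0, 1],
    ![0, 2, 0], ![0, 1, 1], ![0, 0, 2]] : Fin 6 → Fin 3 → ℕ) k)) p, h.trans ?_⟩
  simp [conicForm]
  ring

theorem exists_eq_cubicForm {p : Poly} (hp : p.IsHomogeneous 3) : ∃ q, p = cubicForm q := by
  have h := ternaryForm_eq_sum hp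
  have hd : Finset.Nat.antidiagonalTuple 3 3 =
      {![3, 0, 0], ![2, 1, 0], ![2, 0, 1], ![1, 2, 0], ![1, 1, 1], ![1, 0, 2], ![0, 3, 0],
        ![0, 2, 1], ![0, 1, 2], ![0, 0, 3]} := by decide
  rw [hd, Finset.sum_insert (by decide), Finset.sum_insert (by decide),
    Finset.sum_insert (by decide), Finset.sum_insert (by decide), Finset.sum_insert (by decide),
    Finset.sum_insert (by decide), Finset.sum_insert (by decide), Finset.sum_insert (by decide),
    Finset.sum_insert (by decide), Finset.sum_singleton] at h
  refine ⟨fun k => coeff (Finsupp.equivFunOnFinite.symm ((![![3, 0, 0], ![2, 1, 0], ![2, 0, 1],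
    ![1, 2, 0], ![1, 1, 1], ![1, 0, 2], ![0, 3, 0], ![0, 2, 1], ![0, 1, 2], ![0, 0, 3]] :
      Fin 10 → Fin 3 → ℕ) k)) p, h.trans ?_⟩
  simp [cubicForm]
  ring

theorem eval_conicForm (q : Fin 6 → ℂ) (v : Vec) : eval v (conicForm q) =
    q 0 * v 0 ^ 2 + q 1 * (v 0 * v 1) + q 2 * (v 0 * v 2) + q 3 * v 1 ^ 2 + q 4 * (v 1 * v 2) +
      q 5 * v 2 ^ 2 := by
  simp [conicForm]

theorem eval_cubicForm (q : Fin 10 → ℂ) (v : Vec) : eval v (cubicForm q) =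
    q 0 * v 0 ^ 3 + q 1 * (v 0 ^ 2 * v 1) + q 2 * (v 0 ^ 2 * v 2) + q 3 * (v 0 * v 1 ^ 2) +
      q 4 * (v 0 * v 1 * v 2) + q 5 * (v 0 * v 2 ^ 2) + q 6 * v 1 ^ 3 + q 7 * (v 1 ^ 2 * v 2) +
      q 8 * (v 1 * v 2 ^ 2) + q 9 * v 2 ^ 3 := by
  simp [cubicForm]

theorem pderiv_two (i : Fin 3) : pderiv i (2 : Poly) = 0 := (pderiv i).map_natCast 2

theorem pderiv_three (i : Fin 3) : pderiv i (3 : Poly) = 0 := (pderiv i).map_natCast 3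

/-- The Taylor expansion of a cubic form. -/
theorem eval_smul_add {c : Poly} (hc : c.IsHomogeneous 3) (s : ℂ) (p w : Vec) :
    eval (s • p + w) c = s ^ 3 * eval p c + s ^ 2 * ∑ i, w i * eval p (pderiv i c) +
      s / 2 * (w ⬝ᵥ (hessian c p).mulVec w) + eval w c := by
  obtain ⟨q, rfl⟩ := exists_eq_cubicForm hc
  rw [eval_cubicForm, eval_cubicForm, eval_cubicForm]
  simp [cubicForm, hessian, Matrix.mulVec, dotProduct, Fin.sum_univ_three, pderiv_X,
    pderiv_two, pderiv_three, Pi.single_apply]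
  ring

theorem hessian_mulVec_self {c : Poly} (hc : c.IsHomogeneous 3) (p : Vec) (i : Fin 3) :
    (hessian c p).mulVec p i = 2 * eval p (pderiv i c) := by
  obtain ⟨q, rfl⟩ := exists_eq_cubicForm hc
  fin_cases i <;>
  simp [cubicForm, hessian, Matrix.mulVec, dotProduct, Fin.sum_univ_three, pderiv_X, pderiv_two,
    pderiv_three, Pi.single_apply] <;>
  ring

theorem sum_mul_eval_pderiv {c : Poly} (hc : c.IsHomogeneous 3) (p : Vec) :
    ∑ i, p i * eval p (pderiv i c) = 3 * eval p c := by
  obtain ⟨q, rfl⟩ := exists_eq_cubicForm hc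
  rw [eval_cubicForm]
  simp [cubicForm, Fin.sum_univ_three, pderiv_X, Pi.single_apply]
  ring

theorem hessian_isSymm {c : Poly} (hc : c.IsHomogeneous 3) (p : Vec) : (hessian c p).IsSymm := by
  obtain ⟨q, rfl⟩ := exists_eq_cubicForm hc
  ext i j
  fin_cases i <;> fin_cases j <;>
  simp [cubicForm, hessian, pderiv_X,
    pderiv_two, pderiv_three, Pi.single_apply]

theorem eval_smul_form {p : Poly} {n : ℕ} (hp : p.IsHomogeneous n) (s : ℂ) (v : Vec) :
    eval (s • v) p = s ^ n * eval v p := by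
  rw [ternaryForm_eq_sum hp]
  simp only [map_sum, map_mul, eval_C, map_pow, eval_X, Pi.smul_apply, smul_eq_mul, Finset.mul_sum]
  refine Finset.sum_congr rfl fun d hd => ?_
  have h := Finset.Nat.mem_antidiagonalTuple.1 hd
  rw [Fin.sum_univ_three] at h
  rw [← h]
  ring

/-! ### Linear substitutions -/

/-- The triple of linear forms given by a linear map. -/
noncomputable def linTriple (T : Vec →ₗ[ℂ] Vec) : Fin 3 → Poly :=
  fun i => ∑ j, C (T (Pi.single j 1) i) * X j

theorem linearMap_apply_eq_sum (T : Vec →ₗ[ℂ] Vec) (v : Vec) (i : Fin 3) :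
    T v i = ∑ j, T (Pi.single j 1) i * v j := by
  conv_lhs => rw [pi_eq_sum_univ' v]
  simp [Finset.sum_apply, mul_comm]

theorem evalTriple_linTriple (T : Vec →ₗ[ℂ] Vec) (v : Vec) : evalTriple (linTriple T) v = T v := by
  ext i
  rw [linearMap_apply_eq_sum T v i]
  simp [evalTriple, linTriple]

theorem linTriple_isHomogeneous (T : Vec →ₗ[ℂ] Vec) (i : Fin 3) :
    (linTriple T i).IsHomogeneous 1 :=
  IsHomogeneous.sum _ _ _ fun _ _ => isHomogeneous_C_mul_X _ _

theorem eval_bind₁_triple (F : Fin 3 → Poly) (p : Poly) (v : Vec) :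
    eval v (bind₁ F p) = eval (evalTriple F v) p := by
  rw [eval, eval₂Hom_bind₁]
  rfl

theorem bind₁_isHomogeneous {F : Fin 3 → Poly} {p : Poly} {m n : ℕ} (hp : p.IsHomogeneous m)
    (hF : ∀ i, (F i).IsHomogeneous n) : (bind₁ F p).IsHomogeneous (n * m) :=
  hp.aeval _ hF

/-- The composition `A ∘ F ∘ B` of a triple of polynomials with linear maps. -/
noncomputable def conjTriple (A : Vec →ₗ[ℂ] Vec) (F : Fin 3 → Poly) (B : Vec →ₗ[ℂ] Vec) :
    Fin 3 → Poly :=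
  fun i => bind₁ (linTriple B) (bind₁ F (linTriple A i))

theorem evalTriple_conjTriple (A : Vec →ₗ[ℂ] Vec) (F : Fin 3 → Poly) (B : Vec →ₗ[ℂ] Vec)
    (v : Vec) : evalTriple (conjTriple A F B) v = A (evalTriple F (B v)) := by
  ext i
  rw [evalTriple, conjTriple, eval_bind₁_triple, eval_bind₁_triple, evalTriple_linTriple]
  exact congrFun (evalTriple_linTriple A _) i

theorem conjTriple_isHomogeneous (A : Vec →ₗ[ℂ] Vec) {F : Fin 3 → Poly} {n : ℕ}
    (hF : ∀ i, (F i).IsHomogeneous n) (B : Vec →ₗ[ℂ] Vec) (i : Fin 3) :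
    (conjTriple A F B i).IsHomogeneous n := by
  have h := bind₁_isHomogeneous (bind₁_isHomogeneous (linTriple_isHomogeneous A i) hF)
    (linTriple_isHomogeneous B)
  simpa [conjTriple] using h

theorem triple_ext {F G : Fin 3 → Poly} (h : ∀ v, evalTriple F v = evalTriple G v) : F = G := by
  funext i
  exact MvPolynomial.funext fun v => congrFun (h v) i

theorem evalTriple_smul {F : Fin 3 → Poly} {n : ℕ} (hF : ∀ i, (F i).IsHomogeneous n) (s : ℂ)
    (v : Vec) : evalTriple F (s • v) = s ^ n • evalTriple F v := by
  ext i
  exact eval_smul_form (hF i) s v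

theorem dvd_conjTriple {A : Vec →ₗ[ℂ] Vec} {F : Fin 3 → Poly} {B : Vec →ₗ[ℂ] Vec} {d : Poly}
    (h : ∀ i, d ∣ F i) (i : Fin 3) : bind₁ (linTriple B) d ∣ conjTriple A F B i := by
  refine map_dvd _ ?_
  simp only [linTriple, map_sum, map_mul, bind₁_X_right, algHom_C]
  exact Finset.dvd_sum fun j _ => dvd_mul_of_dvd_right (h j) _

theorem bind₁_linTriple_symm (T : Vec ≃ₗ[ℂ] Vec) (p : Poly) :
    bind₁ (linTriple T.toLinearMap) (bind₁ (linTriple T.symm.toLinearMap) p) = p := by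
  refine MvPolynomial.funext fun v => ?_
  rw [eval_bind₁_triple, eval_bind₁_triple, evalTriple_linTriple, evalTriple_linTriple]
  simp

/-! ### Restriction of forms to the cuspidal cubic -/

theorem eq_zero_of_forall_sum_eq_zero {n : ℕ} (a : Fin n → ℂ)
    (h : ∀ t : ℂ, ∑ i, a i * t ^ (i : ℕ) = 0) (i : Fin n) : a i = 0 := by
  have hF : ∑ d : Fin n, Polynomial.C (a d) * Polynomial.X ^ (d : ℕ) = 0 :=
    Polynomial.funext fun t => by simpa [Polynomial.eval_finsetSum] using h t
  have := congrArg (fun P => Polynomial.coeff P (i : ℕ)) hF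
  simp only [Polynomial.finsetSum_coeff, Polynomial.coeff_C_mul, Polynomial.coeff_X_pow,
    Fin.val_inj, Polynomial.coeff_zero, mul_ite, mul_one, mul_zero, Finset.sum_ite_eq,
    Finset.mem_univ, if_true] at this
  exact this

/-- The coordinate vector `(t, t³, 1)`. -/
def cuspVec (t : ℂ) : Vec := ![t, t ^ 3, 1]

@[simp] theorem cuspVec_zero (t : ℂ) : cuspVec t 0 = t := rfl
@[simp] theorem cuspVec_one (t : ℂ) : cuspVec t 1 = t ^ 3 := rfl
@[simp] theorem cuspVec_two (t : ℂ) : cuspVec t 2 = 1 := rfl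

theorem cuspVec_ne_zero (t : ℂ) : cuspVec t ≠ 0 := fun h => by simpa using congrFun h 2

theorem eval_aeval_polynomial (g : Fin 3 → Polynomial ℂ) (p : Poly) (t : ℂ) :
    (aeval g p).eval t = eval (fun i => (g i).eval t) p := by
  have h : (Polynomial.evalRingHom t).comp (algebraMap ℂ (Polynomial ℂ)) = RingHom.id ℂ := by
    ext
    simp
  rw [← Polynomial.coe_evalRingHom, map_aeval, h]
  rfl

/-- The restriction of a polynomial to the curve `(t, t³, 1)`. -/
noncomputable def curveRestrict (p : Poly) : Polynomial ℂ :=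
  aeval (![Polynomial.X, Polynomial.X ^ 3, 1] : Fin 3 → Polynomial ℂ) p

theorem eval_curveRestrict (p : Poly) (t : ℂ) :
    (curveRestrict p).eval t = eval (cuspVec t) p := by
  rw [curveRestrict, eval_aeval_polynomial]
  congr 2
  funext i
  fin_cases i <;> simp

/-- The quadratic monomials restrict to different powers of `t`. The slot 0 in the coefficient list
is the power `t⁵`, which no monomial produces. -/
theorem conicForm_eq_zero {q : Fin 6 → ℂ} (h : ∀ t, eval (cuspVec t) (conicForm q) = 0) :
    conicForm q = 0 := by
  have hco := eq_zero_of_forall_sum_eq_zero ![q 5, q 2, q 0, q 4, q 1, 0, q 3] fun t => by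
    have := h t
    rw [eval_conicForm] at this
    simp [Fin.sum_univ_succ] at this ⊢
    linear_combination this
  have c0 := hco 0
  have c1 := hco 1
  have c2 := hco 2
  have c3 := hco 3
  have c4 := hco 4
  have c6 := hco 6
  simp at c0 c1 c2 c3 c4 c6
  simp [conicForm, c0, c1, c2, c3, c4, c6]

theorem conic_eq_zero {p : Poly} (hp : p.IsHomogeneous 2) (h : ∀ t, eval (cuspVec t) p = 0) :
    p = 0 := by
  obtain ⟨q, rfl⟩ := exists_eq_conicForm hp
  exact conicForm_eq_zero h

/-! ### Normal form of a cuspidal cubic -/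

/-- The cubic form `x³ - y z²`. -/
def stdCubic (v : Vec) : ℂ := v 0 ^ 3 - v 1 * v 2 ^ 2

/-- In the coordinates given by `M` the cubic form `c` is a multiple of `x³ - y z²`. -/
def HasNormalForm (c : Poly) (M : Vec ≃ₗ[ℂ] Vec) : Prop :=
  ∃ k : ℂ, k ≠ 0 ∧ ∀ v, eval (M v) c = k * stdCubic v

/-- A rank-one matrix is `x yᵀ`, and symmetry makes `y` a multiple of `x`, so the quadratic form is
a scalar times the square of `w ↦ x ⬝ᵥ w`. A square root of the scalar over `ℂ` is absorbed into the
linear form. -/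
theorem exists_sq_of_rank_one {H : Matrix (Fin 3) (Fin 3) ℂ} (hs : H.IsSymm) (hr : H.rank = 1) :
    ∃ ℓ : Module.Dual ℂ Vec, ℓ ≠ 0 ∧ (∀ w, w ⬝ᵥ H.mulVec w = 2 * ℓ w ^ 2) ∧
      ∀ p, H.mulVec p = 0 → ℓ p = 0 := by
  obtain ⟨x, y, hxy⟩ : ∃ x y : Vec, H = Matrix.vecMulVec x y := by
    have h1 : Module.finrank ℂ (LinearMap.range H.mulVecLin) = 1 := hr
    obtain ⟨x, -, hx⟩ := finrank_eq_one_iff'.1 h1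
    choose y hy using fun j : Fin 3 => hx ⟨H.mulVecLin (Pi.single j 1), ⟨_, rfl⟩⟩
    refine ⟨x, y, ?_⟩
    ext i j
    have := congrFun (congrArg Subtype.val (hy j)) i
    simp at this
    rw [Matrix.vecMulVec_apply, ← this, mul_comm]
  have hH : H ≠ 0 := by
    rintro rfl
    simp at hr
  have hx : x ≠ 0 := by
    rintro rfl
    exact hH (by rw [hxy]; ext; simp [Matrix.vecMulVec_apply])
  obtain ⟨i, hi⟩ : ∃ i, x i ≠ 0 := by
    by_contra! h
    exact hx (funext h)
  have hsym : ∀ i j, x i * y j = x j * y i := by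
    intro i j
    have := hs.apply i j
    rw [hxy, Matrix.vecMulVec_apply, Matrix.vecMulVec_apply] at this
    exact this.symm
  have hy : ∀ j, y j = y i / x i * x j := by
    intro j
    rw [div_mul_eq_mul_div, eq_div_iff hi, mul_comm (y j), hsym, mul_comm]
  have hyi : y i ≠ 0 := by
    intro h0
    refine hH ?_
    rw [hxy]
    ext a b
    simp [Matrix.vecMulVec_apply, hy b, h0]
  obtain ⟨r, hr2⟩ := IsAlgClosed.exists_pow_nat_eq (y i / x i / 2) (n := 2) (by norm_num)
  have hr0 : r ≠ 0 := by
    rintro rfl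
    rw [zero_pow two_ne_zero] at hr2
    exact div_ne_zero (div_ne_zero hyi hi) two_ne_zero hr2.symm
  have hHv : ∀ w, H.mulVec w = (y i / x i * (x ⬝ᵥ w)) • x := by
    intro w
    rw [hxy]
    ext a
    simp only [Matrix.mulVec, Matrix.vecMulVec_apply, dotProduct, Pi.smul_apply, smul_eq_mul,
      Finset.mul_sum, Finset.sum_mul]
    refine Finset.sum_congr rfl fun b _ => ?_
    rw [hy b]
    ring
  refine ⟨r • dotProductBilin ℂ ℂ x, ?_, ?_, ?_⟩
  · intro h
    have := LinearMap.congr_fun h (Pi.single i 1)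
    simp [hr0, hi] at this
  · intro w
    rw [hHv]
    simp only [dotProduct_smul, smul_eq_mul, LinearMap.smul_apply, dotProductBilin_apply_apply]
    rw [mul_pow, hr2, dotProduct_comm w x]
    ring
  · intro p hp
    rw [hHv] at hp
    have := congrFun hp i
    simp [hyi, hi] at this
    simp [this]

/-- The linear automorphism of the space of coordinate vectors with the given matrix. -/
noncomputable def linEquivOfInjective (T : Vec →ₗ[ℂ] Vec) (h : ∀ v, T v = 0 → v = 0) :
    Vec ≃ₗ[ℂ] Vec :=
  LinearEquiv.ofInjectiveEndo T (LinearMap.ker_eq_bot.1 (LinearMap.ker_eq_bot'.2 h))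

theorem linEquivOfInjective_apply (T : Vec →ₗ[ℂ] Vec) (h : ∀ v, T v = 0 → v = 0) (v : Vec) :
    linEquivOfInjective T h v = T v := rfl

/-- The kernel of `ℓ` is a plane through `p`: complete `p` to a basis of it by `e₀`, and add a
vector `e₂` on which `ℓ` is 1. -/
theorem exists_frame {ℓ : Module.Dual ℂ Vec} (hℓ : ℓ ≠ 0) {p : Vec} (hp : p ≠ 0) (hlp : ℓ p = 0) :
    ∃ M : Vec ≃ₗ[ℂ] Vec, ∃ e₀ e₂ : Vec, ℓ e₀ = 0 ∧ ℓ e₂ = 1 ∧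
      ∀ v, M v = v 1 • p + (v 0 • e₀ + v 2 • e₂) := by
  obtain ⟨e₂, he₂⟩ := LinearMap.surjective hℓ 1
  obtain ⟨e₀, he₀, he₀'⟩ : ∃ e₀, ℓ e₀ = 0 ∧ e₀ ∉ Submodule.span ℂ {p} := by
    by_contra! h
    have hle : LinearMap.ker ℓ ≤ Submodule.span ℂ {p} := fun x hx => h x hx
    have h1 := Submodule.finrank_mono hle
    have h2 := LinearMap.finrank_range_add_finrank_ker ℓ
    rw [LinearMap.range_eq_top.2 (LinearMap.surjective hℓ)] at h2
    rw [finrank_span_singleton hp] at h1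
    simp at h2
    omega
  refine ⟨linEquivOfInjective (Fintype.linearCombination ℂ ![e₀, p, e₂]) ?_, e₀, e₂, he₀, he₂, ?_⟩
  · intro v hv
    simp only [Fintype.linearCombination_apply, Fin.sum_univ_three, Matrix.cons_val_zero,
      Matrix.cons_val_one, Matrix.cons_val] at hv
    have h2 : v 2 = 0 := by
      have := congrArg ℓ hv
      simpa [he₀, hlp, he₂] using this
    have h0 : v 0 = 0 := by
      by_contra h0
      refine he₀' (Submodule.mem_span_singleton.2 ⟨-(v 1 / v 0), ?_⟩)
      rw [h2, zero_smul, add_zero] at hv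
      have h3 : e₀ = -((v 0)⁻¹ • v 1 • p) := by
        rw [eq_neg_iff_add_eq_zero]
        have := congrArg (fun x => (v 0)⁻¹ • x) hv
        simpa [smul_add, smul_smul, h0] using this
      rw [h3, smul_smul, neg_smul, div_eq_inv_mul]
    have h1 : v 1 = 0 := by
      simpa [h0, h2, hp] using hv
    ext i
    fin_cases i <;> simpa
  · intro v
    rw [linEquivOfInjective_apply]
    simp only [Fintype.linearCombination_apply, Fin.sum_univ_three, Matrix.cons_val_zero,
      Matrix.cons_val_one, Matrix.cons_val]
    abel

theorem exists_eval_eq_cubicForm {c : Poly} (hc : c.IsHomogeneous 3) (M : Vec ≃ₗ[ℂ] Vec) :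
    ∃ q, ∀ v, eval (M v) c = eval v (cubicForm q) := by
  obtain ⟨q, hq⟩ := exists_eq_cubicForm
    (bind₁_isHomogeneous hc (linTriple_isHomogeneous M.toLinearMap))
  refine ⟨q, fun v => ?_⟩
  rw [← hq, eval_bind₁_triple, evalTriple_linTriple]
  rfl

/-- At the cusp the Taylor expansion has only its quadratic and cubic parts, and the former is a
square. In a frame adapted to the cusp and its tangent line the equation is `y z²` plus a cubic in
`x, z`. Completing the cube removes `x² z`, and the terms in `x z²` and `z³` are absorbed into `y`.
-/
theorem IsCuspidalCubic.exists_normalForm {c : Poly} (hc : IsCuspidalCubic c) :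
    ∃ M, HasNormalForm c M := by
  obtain ⟨hom, hirr, p, hsing, hrank⟩ := hc
  obtain ⟨ℓ, hℓ, hquad, hker⟩ := exists_sq_of_rank_one (hessian_isSymm hom _) hrank
  have hp := p.rep_nonzero
  set P := p.rep with hP
  have hlp : ℓ P = 0 := hker _ (by ext i; rw [hessian_mulVec_self hom, hsing]; simp)
  have hcP : eval P c = 0 := by
    have := sum_mul_eval_pderiv hom P
    simpa [hsing] using this.symm
  obtain ⟨M, e₀, e₂, he₀, he₂, hM⟩ := exists_frame hℓ hp hlp
  obtain ⟨q, hq⟩ := exists_eval_eq_cubicForm hom M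
  have hval : ∀ v, eval (M v) c = v 1 * v 2 ^ 2 + (q 0 * v 0 ^ 3 + q 2 * (v 0 ^ 2 * v 2) +
      q 5 * (v 0 * v 2 ^ 2) + q 9 * v 2 ^ 3) := by
    intro v
    -- Evaluating at vectors with `y = 0` identifies the purely cubic Taylor term with a binary
    -- cubic in `x, z`.
    have h1 : M ![v 0, 0, v 2] = v 0 • e₀ + v 2 • e₂ := by
      rw [hM]
      simp
    rw [hM, eval_smul_add hom, hquad, ← h1, hq, eval_cubicForm, hcP, h1]
    simp [hsing, he₀, he₂]
    ring
  -- Without the `x³` term the tangent line `z = 0` would be a component, against irreducibility.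
  have hα : q 0 ≠ 0 := by
    intro hα
    have hfac : c = bind₁ (linTriple M.symm.toLinearMap) (X 2) *
        bind₁ (linTriple M.symm.toLinearMap) (X 1 * X 2 + C (q 2) * X 0 ^ 2 +
          C (q 5) * (X 0 * X 2) + C (q 9) * X 2 ^ 2) := by
      refine MvPolynomial.funext fun v => ?_
      have h := hval (M.symm v)
      rw [M.apply_symm_apply, hα] at h
      rw [h, map_mul, eval_bind₁_triple, eval_bind₁_triple, evalTriple_linTriple]
      simp
      ring
    rcases hirr.isUnit_or_isUnit hfac with h | h <;>
    · have h' := h.map (eval (0 : Vec))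
      rw [eval_bind₁_triple, evalTriple_linTriple] at h'
      simp at h'
  -- The substitution `x ↦ x - h z` completes the cube. `A` and `B` are the negatives of the
  -- resulting coefficients of `x z²` and `z³`, to be cancelled by the new `y`.
  set h := q 2 / (3 * q 0) with hh
  have hh' : 3 * q 0 * h = q 2 := by
    rw [hh]
    field_simp
  set A := -(3 * q 0 * h ^ 2 - 2 * q 2 * h + q 5)
  set B := -(-q 0 * h ^ 3 + q 2 * h ^ 2 - q 5 * h + q 9)
  let N : Vec ≃ₗ[ℂ] Vec := linEquivOfInjective
    (Matrix.toLin' !![1, 0, -h; A, -q 0, B; 0, 0, 1]) (by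
      intro v hv
      have h0 := congrFun hv 0
      have h1 := congrFun hv 1
      have h2 := congrFun hv 2
      simp [Matrix.mulVec, dotProduct, Fin.sum_univ_three] at h0 h1 h2
      simp [h2] at h0 h1
      simp [h0, hα] at h1
      ext i
      fin_cases i <;> simpa)
  refine ⟨N.trans M, q 0, hα, fun v => ?_⟩
  have h0 : N v 0 = v 0 - h * v 2 := by
    simp [N, linEquivOfInjective_apply, Matrix.mulVec, dotProduct, Fin.sum_univ_three]
    ring
  have h1 : N v 1 = A * v 0 - q 0 * v 1 + B * v 2 := by
    simp [N, linEquivOfInjective_apply, Matrix.mulVec, dotProduct, Fin.sum_univ_three]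
    ring
  have h2 : N v 2 = v 2 := by
    simp [N, linEquivOfInjective_apply, Matrix.mulVec, dotProduct, Fin.sum_univ_three]
  rw [LinearEquiv.trans_apply, hval, h0, h1, h2, stdCubic]
  simp only [A, B]
  linear_combination (-v 0 ^ 2 * v 2) * hh'

/-! ### Adapted coordinates -/

@[simp] theorem stdCubic_cuspVec (t : ℂ) : stdCubic (cuspVec t) = 0 := by simp [stdCubic]

theorem eq_smul_cuspVec {v : Vec} (h : stdCubic v = 0) (h2 : v 2 ≠ 0) :
    v = v 2 • cuspVec (v 0 / v 2) := by
  rw [stdCubic, sub_eq_zero] at h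
  ext i
  fin_cases i
  · simp
    field_simp
  · simp
    field_simp
    rw [h]
  · simp

theorem vec_ext {v w : Vec} (h0 : v 0 = w 0) (h1 : v 1 = w 1) (h2 : v 2 = w 2) : v = w := by
  ext i
  fin_cases i <;> assumption

theorem eq_zero_of_forall_linear_cuspVec {ℓ : Module.Dual ℂ Vec} (h : ∀ t, ℓ (cuspVec t) = 0) :
    ℓ = 0 := by
  have hℓ : ∀ v, ℓ v = ℓ (Pi.single 0 1) * v 0 + ℓ (Pi.single 1 1) * v 1 +
      ℓ (Pi.single 2 1) * v 2 := by
    intro v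
    conv_lhs => rw [pi_eq_sum_univ' v]
    simp [Fin.sum_univ_three, mul_comm]
  have hco := eq_zero_of_forall_sum_eq_zero ![ℓ (Pi.single 2 1), ℓ (Pi.single 0 1), 0,
    ℓ (Pi.single 1 1)] fun t => by
      have := h t
      rw [hℓ] at this
      simp [Fin.sum_univ_succ] at this ⊢
      linear_combination this
  have h0 := hco 0
  have h1 := hco 1
  have h3 := hco 3
  simp at h0 h1 h3
  ext v
  rw [LinearMap.comp_apply, LinearMap.comp_apply, hℓ]
  simp [h0, h1, h3]

theorem stdCubic_eq_zero_cases {v : Vec} (h : stdCubic v = 0) :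
    (∃ s t : ℂ, v = s • cuspVec t) ∨ v = v 1 • Pi.single 1 1 := by
  by_cases h2 : v 2 = 0
  · right
    have h0 : v 0 = 0 := by simpa [stdCubic, h2] using h
    exact vec_ext (by simp [h0]) (by simp) (by simp [h2])
  · exact Or.inl ⟨_, _, eq_smul_cuspVec h h2⟩

theorem param_eq_mk (M : Vec ≃ₗ[ℂ] Vec) (t : ℂ) :
    param M t = Projectivization.mk ℂ (M (cuspVec t))
      (fun h => cuspVec_ne_zero t (M.map_eq_zero_iff.1 h)) := rfl

theorem exists_rep_param (M : Vec ≃ₗ[ℂ] Vec) (t : ℂ) :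
    ∃ s : ℂ, s ≠ 0 ∧ (param M t).rep = s • M (cuspVec t) := by
  rw [param_eq_mk]
  obtain ⟨a, ha⟩ := Projectivization.exists_smul_eq_mk_rep ℂ (M (cuspVec t))
    (fun h => cuspVec_ne_zero t (M.map_eq_zero_iff.1 h))
  exact ⟨a, a.ne_zero, ha.symm⟩

theorem eq_param_of_rep {M : Vec ≃ₗ[ℂ] Vec} {p : P2} {s t : ℂ} (h : p.rep = s • M (cuspVec t)) :
    p = param M t := by
  rw [← p.mk_rep, param_eq_mk, Projectivization.mk_eq_mk_iff']
  exact ⟨s, h.symm⟩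

theorem eq_of_cuspVec_eq_smul {t t' s : ℂ}
    (h : cuspVec t = s • cuspVec t') : t = t' := by
  have h2 := congrFun h 2
  have h0 := congrFun h 0
  simp at h2 h0
  rw [h0, ← h2, one_mul]

theorem param_injective (M : Vec ≃ₗ[ℂ] Vec) : Function.Injective (param M) := by
  intro t t' h
  rw [param_eq_mk, param_eq_mk, Projectivization.mk_eq_mk_iff'] at h
  obtain ⟨s, hs⟩ := h
  rw [← map_smul, M.injective.eq_iff] at hs
  exact eq_of_cuspVec_eq_smul hs.symm

namespace HasNormalForm

variable {c : Poly} {M : Vec ≃ₗ[ℂ] Vec}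

theorem mem_curve (h : HasNormalForm c M) (p : P2) :
    p ∈ curve c ↔ stdCubic (M.symm p.rep) = 0 := by
  obtain ⟨k, hk, h⟩ := h
  have := h (M.symm p.rep)
  rw [M.apply_symm_apply] at this
  rw [curve, Set.mem_ofPred_eq, this]
  simp [hk]

/-- Adding the Taylor expansions at `v + w` and `-v + w` cancels the terms of odd degree in `v` and
leaves the directional derivative. -/
theorem sum_mul_eval_pderiv (hc : c.IsHomogeneous 3) {k : ℂ}
    (h : ∀ v, eval (M v) c = k * stdCubic v) (v w : Vec) :
    ∑ i, M w i * eval (M v) (pderiv i c) =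
      k * (3 * v 0 ^ 2 * w 0 - 2 * v 1 * v 2 * w 2 - v 2 ^ 2 * w 1) := by
  have e1 := eval_smul_add hc 1 (M v) (M w)
  have e2 := eval_smul_add hc (-1) (M v) (M w)
  rw [← map_smul, ← map_add, h, h, h] at e1 e2
  simp only [stdCubic, Pi.add_apply, Pi.smul_apply, smul_eq_mul] at e1 e2
  linear_combination (-1/2) * e1 + (-1/2) * e2

/-- On the curve, `z = 0` forces `x = 0`, and there the whole gradient vanishes. Where `z ≠ 0` the
derivative in the `y` direction is a nonzero multiple of `z²`. -/
theorem mem_regPts (hc : c.IsHomogeneous 3) (h : HasNormalForm c M) (p : P2) :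
    p ∈ regPts c ↔ stdCubic (M.symm p.rep) = 0 ∧ M.symm p.rep 2 ≠ 0 := by
  rw [regPts, Set.mem_ofPred_eq, h.mem_curve]
  refine and_congr_right fun hp => ?_
  obtain ⟨k, hk, h⟩ := h
  have key := sum_mul_eval_pderiv hc h (M.symm p.rep)
  rw [M.apply_symm_apply] at key
  set v := M.symm p.rep with hv
  constructor
  · rintro ⟨i, hi⟩ h2
    have h0 : v 0 = 0 := by
      simpa [stdCubic, h2] using hp
    have := key (M.symm (Pi.single i 1))
    rw [M.apply_symm_apply] at this
    simp [Pi.single_apply, h2, h0] at this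
    exact hi this
  · intro h2
    by_contra! h0
    have := key (Pi.single 1 1)
    simp [h0, hk, h2] at this

theorem isAdapted (hc : c.IsHomogeneous 3) (h : HasNormalForm c M) : IsAdapted c M := by
  ext p
  rw [h.mem_regPts hc]
  constructor
  · rintro ⟨t, rfl⟩
    obtain ⟨s, hs, hrep⟩ := exists_rep_param M t
    rw [hrep, map_smul, M.symm_apply_apply]
    simp [stdCubic, hs]
    ring
  · rintro ⟨h3, h2⟩
    refine ⟨M.symm p.rep 0 / M.symm p.rep 2, ?_⟩
    refine (eq_param_of_rep (s := M.symm p.rep 2) ?_).symm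
    rw [← map_smul, ← eq_smul_cuspVec h3 h2, M.apply_symm_apply]

end HasNormalForm

/-- Among the restrictions of the ten cubic monomials to `(t, t³, 1)`, only those of `x³` and `y z²`
coincide. A cubic vanishing on the curve is therefore a multiple of their difference. -/
theorem IsAdapted.hasNormalForm {c : Poly} {M : Vec ≃ₗ[ℂ] Vec} (hc : c.IsHomogeneous 3)
    (hc0 : c ≠ 0) (h : IsAdapted c M) : HasNormalForm c M := by
  obtain ⟨q, hq⟩ := exists_eval_eq_cubicForm hc M
  have hvan : ∀ t, eval (cuspVec t) (cubicForm q) = 0 := by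
    intro t
    have h1 : param M t ∈ regPts c := by
      rw [← h]
      exact ⟨t, rfl⟩
    have h2 : eval (param M t).rep c = 0 := h1.1
    obtain ⟨s, hs, hrep⟩ := exists_rep_param M t
    rw [hrep, eval_smul_form hc, hq] at h2
    simpa [hs] using h2
  have hco := eq_zero_of_forall_sum_eq_zero ![q 9, q 5, q 2, q 0 + q 8, q 4, q 1, q 7, q 3, 0,
    q 6] fun t => by
      have := hvan t
      rw [eval_cubicForm] at this
      simp [Fin.sum_univ_succ] at this ⊢
      linear_combination this
  have c0 := hco 0
  have c1 := hco 1
  have c2 := hco 2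
  have c3 := hco 3
  have c4 := hco 4
  have c5 := hco 5
  have c6 := hco 6
  have c7 := hco 7
  have c9 := hco 9
  simp at c0 c1 c2 c3 c4 c5 c6 c7 c9
  have hval : ∀ v, eval (M v) c = q 0 * stdCubic v := by
    intro v
    rw [hq, eval_cubicForm, stdCubic, c0, c1, c2, c4, c5, c6, c7, c9]
    linear_combination v 1 * v 2 ^ 2 * c3
  refine ⟨q 0, fun h0 => hc0 (MvPolynomial.funext fun v => ?_), hval⟩
  have := hval (M.symm v)
  rw [M.apply_symm_apply, h0] at this
  simpa using this

/-! ### The model quadratic transformation -/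

/-- The triple of quadratic forms that restricts to `s(t) (t + β, (t + β)³, 1)` on the curve
`(t, t³, 1)`, where `s` is the monic cubic polynomial with roots `u` and `3 β` is the sum of the
roots. -/
noncomputable def modelTriple (u : Fin 3 → ℂ) : Fin 3 → Poly :=
  let σ₁ := u 0 + u 1 + u 2
  let σ₂ := u 0 * u 1 + u 0 * u 2 + u 1 * u 2
  let σ₃ := u 0 * u 1 * u 2
  let β := σ₁ / 3
  ![conicForm ![σ₂ - β * σ₁, 1, β * σ₂ - σ₃, 0, β - σ₁, -β * σ₃],
    conicForm ![-σ₁ * β ^ 3 + 3 * β ^ 2 * σ₂ - σ₁ * σ₃, 3 * β ^ 2 - σ₁ ^ 2 + σ₂,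
      σ₂ * β ^ 3 - 3 * β ^ 2 * σ₃, 1, β ^ 3 - 3 * β ^ 2 * σ₁ + σ₁ * σ₂ - σ₃, -β ^ 3 * σ₃],
    conicForm ![-σ₁, 0, σ₂, 0, 1, -σ₃]]

/-- The linear map `diag(a, a³, 1)`. -/
noncomputable def scaling (a : ℂ) : Vec →ₗ[ℂ] Vec :=
  Matrix.toLin' (Matrix.diagonal ![a, a ^ 3, 1])

@[simp] theorem scaling_zero (a : ℂ) (v : Vec) : scaling a v 0 = a * v 0 := by
  simp [scaling, Matrix.mulVec_diagonal]
@[simp] theorem scaling_one (a : ℂ) (v : Vec) : scaling a v 1 = a ^ 3 * v 1 := by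
  simp [scaling, Matrix.mulVec_diagonal]
@[simp] theorem scaling_two (a : ℂ) (v : Vec) : scaling a v 2 = v 2 := by
  simp [scaling, Matrix.mulVec_diagonal]

theorem scaling_cuspVec (a t : ℂ) : scaling a (cuspVec t) = cuspVec (a * t) :=
  vec_ext (by simp) (by simp; ring) (by simp)

/-- In the coordinates `M`, the map is `k · diag(a, a³, 1) ∘ modelTriple u`. -/
def QuadraticTransformation.HasModel (f : QuadraticTransformation) (M : Vec ≃ₗ[ℂ] Vec) (a k : ℂ)
    (u : Fin 3 → ℂ) : Prop :=
  ∀ v, evalTriple f.fwd (M v) = k • M (scaling a (evalTriple (modelTriple u) v))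

/-! ### Regular self-maps of the affine line -/

/-- Zeros of the denominator of a global fraction `F₀ / F₂` for `T` can be cancelled one at a time.
The numerator vanishes there too because `T` is finite, and the local fraction at that point shows
that the reduced fraction still has the value of `T` there. -/
theorem exists_polynomial_of_locally_rational (T : ℂ → ℂ)
    (hloc : ∀ t₀, ∃ A₀ A₂ : Polynomial ℂ, A₂.eval t₀ ≠ 0 ∧ ∀ t, A₀.eval t = T t * A₂.eval t) :
    ∀ (n : ℕ) (F₀ F₂ : Polynomial ℂ), F₂.natDegree = n → F₂ ≠ 0 →
      (∀ t, F₀.eval t = T t * F₂.eval t) → ∃ P : Polynomial ℂ, ∀ t, T t = P.eval t := by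
  intro n
  induction n with
  | zero =>
    intro F₀ F₂ hn h0 h
    rw [Polynomial.eq_C_of_natDegree_eq_zero hn] at h h0
    have hc : F₂.coeff 0 ≠ 0 := fun hc => h0 (by simp [hc])
    refine ⟨Polynomial.C (F₂.coeff 0)⁻¹ * F₀, fun t => ?_⟩
    rw [Polynomial.eval_mul, Polynomial.eval_C, h, Polynomial.eval_C]
    field_simp
  | succ n ih =>
    intro F₀ F₂ hn h0 h
    obtain ⟨t₀, ht₀⟩ := IsAlgClosed.exists_root F₂ (by
      rw [Polynomial.degree_eq_natDegree h0, hn]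
      exact_mod_cast n.succ_ne_zero)
    have ht₀' : F₀.IsRoot t₀ := by
      rw [Polynomial.IsRoot, h, ht₀.eq_zero, mul_zero]
    obtain ⟨G₂, hG₂⟩ := Polynomial.dvd_iff_isRoot.2 ht₀
    obtain ⟨G₀, hG₀⟩ := Polynomial.dvd_iff_isRoot.2 ht₀'
    have hG0 : G₂ ≠ 0 := by
      rintro rfl
      simp [h0] at hG₂
    refine ih G₀ G₂ ?_ hG0 fun t => ?_
    · rw [hG₂, Polynomial.natDegree_mul (Polynomial.X_sub_C_ne_zero _) hG0,
        Polynomial.natDegree_X_sub_C] at hn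
      omega
    · obtain ⟨A₀, A₂, hA, hAT⟩ := hloc t₀
      have hid : G₀ * A₂ = G₂ * A₀ := by
        refine mul_left_cancel₀ (Polynomial.X_sub_C_ne_zero t₀) ?_
        rw [← mul_assoc, ← mul_assoc, ← hG₀, ← hG₂]
        refine Polynomial.funext fun s => ?_
        rw [Polynomial.eval_mul, Polynomial.eval_mul, h, hAT]
        ring
      by_cases ht : t = t₀
      · subst ht
        have := congrArg (Polynomial.eval t) hid
        rw [Polynomial.eval_mul, Polynomial.eval_mul, hAT] at this
        refine mul_right_cancel₀ hA ?_
        rw [this]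
        ring
      · have := h t
        rw [hG₀, hG₂, Polynomial.eval_mul, Polynomial.eval_mul] at this
        refine mul_left_cancel₀ (a := Polynomial.eval t (Polynomial.X - Polynomial.C t₀)) ?_ ?_
        · simpa [sub_eq_zero] using ht
        · rw [this]
          ring

/-! ### The restriction of a transformation to the smooth part. -/

namespace QuadraticTransformation

variable {f : QuadraticTransformation} {c : Poly} {M : Vec ≃ₗ[ℂ] Vec}

theorem not_forall_fwd_eq_zero (f : QuadraticTransformation) (h : ∀ i, f.fwd i = 0) : False :=
  not_isUnit_zero (f.fwd_prim 0 fun i => by rw [h i])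

theorem not_forall_bwd_eq_zero (f : QuadraticTransformation) (h : ∀ i, f.bwd i = 0) : False :=
  not_isUnit_zero (f.bwd_prim 0 fun i => by rw [h i])

theorem eq_zero_of_conjTriple_eq_zero {F : Fin 3 → Poly}
    (h : ∀ i, conjTriple M.symm.toLinearMap F M.toLinearMap i = 0) (i : Fin 3) : F i = 0 := by
  refine MvPolynomial.funext fun v => ?_
  have h1 := evalTriple_conjTriple M.symm.toLinearMap F M.toLinearMap (M.symm v)
  have h2 : evalTriple (conjTriple M.symm.toLinearMap F M.toLinearMap) (M.symm v) = 0 := by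
    ext j
    simp [evalTriple, h j]
  rw [h2] at h1
  rw [LinearEquiv.coe_coe, LinearEquiv.coe_coe, M.apply_symm_apply] at h1
  exact congrFun (M.symm.map_eq_zero_iff.1 h1.symm) i

theorem exists_smul_cuspVec {A : Fin 3 → Poly} {d : ℕ} (hA : ∀ i, (A i).IsHomogeneous d)
    {t t' s : ℂ} (h : evalTriple A (param M t).rep = s • (param M t').rep) :
    ∃ r : ℂ, evalTriple A (M (cuspVec t)) = r • M (cuspVec t') := by
  obtain ⟨s₁, h₁, e₁⟩ := exists_rep_param M t
  obtain ⟨s₂, -, e₂⟩ := exists_rep_param M t'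
  rw [e₁, e₂, evalTriple_smul hA, smul_smul] at h
  refine ⟨(s₁ ^ d)⁻¹ * (s * s₂), ?_⟩
  rw [mul_smul, ← h, smul_smul, inv_mul_cancel₀ (pow_ne_zero _ h₁), one_smul]

theorem evalTriple_param_eq_zero_iff {A : Fin 3 → Poly} {d : ℕ} (hA : ∀ i, (A i).IsHomogeneous d)
    (t : ℂ) : evalTriple A (param M t).rep = 0 ↔ evalTriple A (M (cuspVec t)) = 0 := by
  obtain ⟨s₁, h₁, e₁⟩ := exists_rep_param M t
  rw [e₁, evalTriple_smul hA, smul_eq_zero_iff_right (pow_ne_zero _ h₁)]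

/-- The restriction of the map to the smooth part is polynomial. -/
theorem IsRestriction.exists_polynomial {τ : regPts c → regPts c} (hτ : f.IsRestriction c τ)
    (hM : IsAdapted c M) :
    ∃ P F : Polynomial ℂ, F ≠ 0 ∧
      (∀ t, evalTriple f.fwd (M (cuspVec t)) = F.eval t • M (cuspVec (P.eval t))) ∧
      ∀ (p : regPts c) (t : ℂ), (p : P2) = param M t → (τ p : P2) = param M (P.eval t) := by
  have hreg : ∀ t, param M t ∈ regPts c := fun t => by
    rw [← hM]
    exact ⟨t, rfl⟩
  have hT : ∀ t, ∃ t', param M t' = (τ ⟨param M t, hreg t⟩ : P2) := fun t =>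
    hM.ge (τ ⟨param M t, hreg t⟩).2
  choose T hT using hT
  let cr : (Fin 3 → Poly) → Fin 3 → Polynomial ℂ := fun A i =>
    curveRestrict (conjTriple M.symm.toLinearMap A M.toLinearMap i)
  have hcr : ∀ A i t, (cr A i).eval t = M.symm (evalTriple A (M (cuspVec t))) i := by
    intro A i t
    rw [eval_curveRestrict]
    exact congrFun (evalTriple_conjTriple M.symm.toLinearMap A M.toLinearMap (cuspVec t)) i
  have hrel : ∀ (A : Fin 3 → Poly) t r, evalTriple A (M (cuspVec t)) = r • M (cuspVec (T t)) →
      (cr A 0).eval t = T t * (cr A 2).eval t ∧ (cr A 2).eval t = r := by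
    intro A t r h
    rw [hcr, hcr, h, map_smul, M.symm_apply_apply]
    simp [mul_comm]
  have hfwd : ∀ t, ∃ r : ℂ, evalTriple f.fwd (M (cuspVec t)) = r • M (cuspVec (T t)) := by
    intro t
    by_cases h : param M t ∈ f.indet
    · exact ⟨0, by rw [zero_smul, ← evalTriple_param_eq_zero_iff f.fwd_hom]; exact h⟩
    · obtain ⟨-, s, hs⟩ := hτ.agrees ⟨param M t, hreg t⟩ h
      rw [← hT] at hs
      exact exists_smul_cuspVec f.fwd_hom hs
  choose r hr using hfwd
  -- Since `cuspVec` has last coordinate 1, this polynomial is the scalar factor `r`. If it vanished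
  -- identically, all three forms would vanish on the curve and hence be zero.
  have hF : cr f.fwd 2 ≠ 0 := by
    intro h0
    refine f.not_forall_fwd_eq_zero (eq_zero_of_conjTriple_eq_zero (M := M) fun i => ?_)
    refine conic_eq_zero (conjTriple_isHomogeneous _ f.fwd_hom _ i) fun t => ?_
    have h1 := (hrel f.fwd t (r t) (hr t)).2
    rw [h0, Polynomial.eval_zero] at h1
    rw [← eval_curveRestrict]
    change (cr f.fwd i).eval t = 0
    rw [hcr, hr, ← h1]
    simp
  obtain ⟨P, hP⟩ := exists_polynomial_of_locally_rational T (by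
    intro t₀
    obtain ⟨d, A, hA, h0, hAτ⟩ := hτ.regular ⟨param M t₀, hreg t₀⟩
    have hA' : ∀ t, ∃ r : ℂ, evalTriple A (M (cuspVec t)) = r • M (cuspVec (T t)) := by
      intro t
      by_cases h : evalTriple A (param M t).rep = 0
      · exact ⟨0, by rw [zero_smul, ← evalTriple_param_eq_zero_iff hA]; exact h⟩
      · obtain ⟨s, hs⟩ := hAτ ⟨param M t, hreg t⟩ h
        rw [← hT] at hs
        exact exists_smul_cuspVec hA hs
    choose r' hr' using hA'
    refine ⟨cr A 0, cr A 2, ?_, fun t => (hrel A t _ (hr' t)).1⟩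
    rw [(hrel A t₀ _ (hr' t₀)).2]
    intro h
    rw [Ne, evalTriple_param_eq_zero_iff hA, hr', h, zero_smul] at h0
    exact h0 rfl) _ (cr f.fwd 0) (cr f.fwd 2) rfl hF fun t => (hrel f.fwd t _ (hr t)).1
  refine ⟨P, cr f.fwd 2, hF, fun t => ?_, fun p t hp => ?_⟩
  · rw [(hrel f.fwd t _ (hr t)).2, hr, hP]
  · obtain ⟨p, hp'⟩ := p
    subst hp
    rw [← hT, hP]

/-- The curve is not contracted to a point. -/
theorem ProperlyFixes.not_constant (hf : f.ProperlyFixes c) (hN : HasNormalForm c M)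
    {F : ℂ → ℂ} {w : ℂ} (h : ∀ t, evalTriple f.fwd (M (cuspVec t)) = F t • M (cuspVec w)) :
    False := by
  -- A line through the supposed constant image and the image of the cusp contains the image of the
  -- whole curve, hence its closure. The cubic, being its own proper transform, would then lie on a
  -- line.
  obtain ⟨ℓ, hℓ, hker⟩ : ∃ ℓ : Module.Dual ℂ Vec, ℓ ≠ 0 ∧
      Submodule.span ℂ {M (cuspVec w), evalTriple f.fwd (M (Pi.single 1 1))} ≤
        LinearMap.ker ℓ := by
    refine Submodule.exists_le_ker_of_lt_top _ (lt_top_iff_ne_top.2 fun htop => ?_)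
    classical
    have h1 := finrank_span_finset_le_card (R := ℂ)
      ({M (cuspVec w), evalTriple f.fwd (M (Pi.single 1 1))} : Finset Vec)
    have h2 := h1.trans Finset.card_le_two
    rw [Finset.coe_insert, Finset.coe_singleton, Set.finrank, htop, finrank_top] at h2
    simp at h2
  have hw : ℓ (M (cuspVec w)) = 0 := hker (Submodule.subset_span (by simp))
  have hcusp : ℓ (evalTriple f.fwd (M (Pi.single 1 1))) = 0 :=
    hker (Submodule.subset_span (by simp))
  have himg : ∀ v, stdCubic v = 0 → ℓ (evalTriple f.fwd (M v)) = 0 := by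
    intro v hv
    rcases stdCubic_eq_zero_cases hv with ⟨s, t, rfl⟩ | hv
    · rw [map_smul, evalTriple_smul f.fwd_hom, h, map_smul, map_smul, hw]
      simp
    · rw [hv, map_smul, evalTriple_smul f.fwd_hom, map_smul, hcusp, smul_zero]
  have hform : ∀ v, eval v (∑ j, C (ℓ (Pi.single j 1)) * X j : Poly) = ℓ v := by
    intro v
    conv_rhs => rw [pi_eq_sum_univ' v]
    simp [mul_comm]
  refine hℓ ?_
  have h0 : ℓ ∘ₗ M.toLinearMap = 0 := by
    refine eq_zero_of_forall_linear_cuspVec fun t => ?_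
    have hmem : param M t ∈ f.properTransform (curve c) := by
      rw [hf.fixes, hN.mem_curve]
      obtain ⟨s, -, hs⟩ := exists_rep_param M t
      rw [hs, map_smul, M.symm_apply_apply, stdCubic]
      simp
      ring
    have := hmem 1 (∑ j, C (ℓ (Pi.single j 1)) * X j)
      (IsHomogeneous.sum _ _ _ fun _ _ => isHomogeneous_C_mul_X _ _) (by
        rintro q ⟨p, hp, hpi, s, hs⟩
        rw [hform]
        rw [hN.mem_curve] at hp
        have h1 := himg _ hp
        rw [M.apply_symm_apply, hs, map_smul, smul_eq_zero] at h1
        refine h1.resolve_left ?_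
        rintro rfl
        rw [zero_smul] at hs
        exact hpi hs)
    rw [hform] at this
    obtain ⟨s, hs0, hs⟩ := exists_rep_param M t
    rw [hs, map_smul, smul_eq_zero] at this
    exact this.resolve_left hs0
  ext v
  have := LinearMap.congr_fun h0 (M.symm (Pi.single v 1))
  simpa using this

end QuadraticTransformation

/-! ### Every transformation properly fixing the cubic is a model. -/

namespace QuadraticTransformation

variable {f : QuadraticTransformation} {c : Poly} {M : Vec ≃ₗ[ℂ] Vec}

/-- The inverse, restricted to the curve, gives an identity `B₀(P(t)) = t B₂(P(t))` with `B₂ ∘ P ≠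
0`. Comparing degrees, `deg B₀ · deg P = 1 + deg B₂ · deg P`, so `deg P` divides 1. -/
theorem natDegree_eq_one_of_inverse (hf : f.ProperlyFixes c) (hN : HasNormalForm c M)
    {P F : Polynomial ℂ} (hF : F ≠ 0)
    (h : ∀ t, evalTriple f.fwd (M (cuspVec t)) = F.eval t • M (cuspVec (P.eval t))) :
    P.natDegree = 1 := by
  have hP : P.natDegree ≠ 0 := by
    intro hP
    rw [Polynomial.eq_C_of_natDegree_eq_zero hP] at h
    simp only [Polynomial.eval_C] at h
    exact hf.not_constant hN h
  obtain ⟨e, -, he⟩ := f.bwd_fwd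
  let B : Fin 3 → Poly := conjTriple M.symm.toLinearMap f.bwd M.toLinearMap
  have hB : ∀ i, (B i).IsHomogeneous 2 := conjTriple_isHomogeneous _ f.bwd_hom _
  have hBP : ∀ i t, F.eval t ^ 2 * ((curveRestrict (B i)).comp P).eval t =
      eval (M (cuspVec t)) e * cuspVec t i := by
    intro i t
    have h1 : evalTriple f.bwd (evalTriple f.fwd (M (cuspVec t))) =
        eval (M (cuspVec t)) e • M (cuspVec t) := by
      ext j
      have := congrArg (eval (M (cuspVec t))) (he j)
      rw [eval_bind₁_triple, map_mul, eval_X] at this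
      exact this
    rw [h, evalTriple_smul f.bwd_hom] at h1
    have h2 := congrFun (evalTriple_conjTriple M.symm.toLinearMap f.bwd M.toLinearMap
      (cuspVec (P.eval t))) i
    rw [Polynomial.eval_comp, eval_curveRestrict]
    change F.eval t ^ 2 * evalTriple B _ i = _
    rw [h2]
    have h3 := congrFun (congrArg M.symm h1) i
    rw [map_smul, map_smul, M.symm_apply_apply] at h3
    exact h3
  have hcomp : ∀ i, (curveRestrict (B i)).comp P =
      (![Polynomial.X, Polynomial.X ^ 3, 1] : Fin 3 → Polynomial ℂ) i *
        (curveRestrict (B 2)).comp P := by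
    intro i
    refine mul_left_cancel₀ (pow_ne_zero 2 hF) (Polynomial.funext fun t => ?_)
    have h2 := hBP 2 t
    rw [Polynomial.eval_mul, Polynomial.eval_pow, hBP, mul_left_comm, Polynomial.eval_mul,
      Polynomial.eval_mul, Polynomial.eval_pow, h2]
    fin_cases i <;> simp <;> ring
  have h2 : (curveRestrict (B 2)).comp P ≠ 0 := by
    intro h2
    refine f.not_forall_bwd_eq_zero (eq_zero_of_conjTriple_eq_zero (M := M) fun i => ?_)
    refine conic_eq_zero (hB i) fun t => ?_
    have h3 := hcomp i
    rw [h2, mul_zero, Polynomial.comp_eq_zero_iff] at h3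
    rcases h3 with h3 | ⟨-, h3⟩
    · rw [← eval_curveRestrict, h3, Polynomial.eval_zero]
    · exact absurd (by rw [h3, Polynomial.natDegree_C]) hP
  have h0 := congrArg Polynomial.natDegree (hcomp 0)
  rw [Matrix.cons_val_zero, Polynomial.natDegree_mul Polynomial.X_ne_zero h2,
    Polynomial.natDegree_X, Polynomial.natDegree_comp, Polynomial.natDegree_comp] at h0
  refine Nat.dvd_one.1 ((Nat.dvd_add_left (dvd_mul_left _ (curveRestrict (B 2)).natDegree)).1 ?_)
  rw [← h0]
  exact dvd_mul_left _ _

theorem exists_roots_of_natDegree_eq_three {F : Polynomial ℂ} (h : F.natDegree = 3) :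
    ∃ (k : ℂ) (u : Fin 3 → ℂ), k ≠ 0 ∧
      ∀ t, F.eval t = k * ((t - u 0) * (t - u 1) * (t - u 2)) := by
  have hs := IsAlgClosed.splits F
  have hcard : F.roots.card = 3 := by rw [← hs.natDegree_eq_card_roots, h]
  obtain ⟨x, y, z, hr⟩ := Multiset.card_eq_three.1 hcard
  refine ⟨F.leadingCoeff, ![x, y, z], ?_, fun t => ?_⟩
  · rw [Ne, Polynomial.leadingCoeff_eq_zero]
    rintro rfl
    simp at h
  · conv_lhs => rw [hs.eq_prod_roots, hr]
    simp
    left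
    ring

/-- A quadratic form is known from its restriction to the curve, so it suffices to know the
polynomial factor `F` and the affine map `a t + b`. The proof shows that `F` is a cubic and that its
roots determine `b / a`. -/
theorem exists_model (hc : c.IsHomogeneous 3) (hN : HasNormalForm c M) (hf : f.ProperlyFixes c)
    {τ : regPts c → regPts c} (hτ : f.IsRestriction c τ) :
    ∃ a k u, a ≠ 0 ∧ k ≠ 0 ∧ f.HasModel M a k u ∧
      ∀ (p : regPts c) (t : ℂ), (p : P2) = param M t →
        (τ p : P2) = param M (a * t + a * (u 0 + u 1 + u 2) / 3) := by
  obtain ⟨P, F, hF, hfwd, hτP⟩ := hτ.exists_polynomial (hN.isAdapted hc)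
  have hdeg := natDegree_eq_one_of_inverse hf hN hF hfwd
  obtain ⟨a, ha, b, rfl⟩ := Polynomial.natDegree_eq_one.1 hdeg
  simp only [Polynomial.eval_add, Polynomial.eval_mul, Polynomial.eval_C, Polynomial.eval_X]
    at hfwd hτP
  let G : Fin 3 → Poly := conjTriple M.symm.toLinearMap f.fwd M.toLinearMap
  have hG : ∀ v, evalTriple G v = M.symm (evalTriple f.fwd (M v)) :=
    evalTriple_conjTriple M.symm.toLinearMap f.fwd M.toLinearMap
  choose q hq using fun i => exists_eq_conicForm
    (conjTriple_isHomogeneous M.symm.toLinearMap f.fwd_hom M.toLinearMap i)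
  have hGq : ∀ i v, evalTriple G v i = eval v (conicForm (q i)) := fun i v => by
    rw [← hq]
    rfl
  have hGt : ∀ i t, eval (cuspVec t) (conicForm (q i)) = F.eval t * cuspVec (a * t + b) i := by
    intro i t
    rw [← hGq, hG, hfwd, map_smul, M.symm_apply_apply]
    rfl
  -- The second coordinate `F(t) (a t + b)³` is a quadratic form in `(t, t³, 1)`, hence of degree at
  -- most 6.
  have hdegF : F.natDegree ≤ 3 := by
    have hF1 : F * (Polynomial.C a * Polynomial.X + Polynomial.C b) ^ 3 =
        Polynomial.C (q 1 5) + Polynomial.C (q 1 2) * Polynomial.X +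
          Polynomial.C (q 1 0) * Polynomial.X ^ 2 + Polynomial.C (q 1 4) * Polynomial.X ^ 3 +
          Polynomial.C (q 1 1) * Polynomial.X ^ 4 + Polynomial.C (q 1 3) * Polynomial.X ^ 6 := by
      refine Polynomial.funext fun t => ?_
      have := hGt 1 t
      rw [eval_conicForm] at this
      simp at this ⊢
      linear_combination -this
    have h6 := congrArg Polynomial.natDegree hF1
    rw [Polynomial.natDegree_mul hF (pow_ne_zero 3 (fun h => by simp [h] at hdeg)),
      Polynomial.natDegree_pow, hdeg] at h6
    have h7 : (Polynomial.C (q 1 5) + Polynomial.C (q 1 2) * Polynomial.X +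
          Polynomial.C (q 1 0) * Polynomial.X ^ 2 + Polynomial.C (q 1 4) * Polynomial.X ^ 3 +
          Polynomial.C (q 1 1) * Polynomial.X ^ 4 +
          Polynomial.C (q 1 3) * Polynomial.X ^ 6).natDegree ≤ 6 := by compute_degree
    omega
  have hFt : ∀ t, F.eval t = F.coeff 0 + F.coeff 1 * t + F.coeff 2 * t ^ 2 + F.coeff 3 * t ^ 3 := by
    intro t
    rw [Polynomial.eval_eq_sum_range' (Nat.lt_succ_of_le hdegF)]
    simp [Finset.sum_range_succ]
  -- The coefficients of a conic, listed by the power of `t` to which their monomials restrict; the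
  -- entry for `t⁵` is 0.
  have co : ∀ i (w : Fin 7 → ℂ), (∀ t, eval (cuspVec t) (conicForm (q i)) =
      ∑ j, w j * t ^ (j : ℕ)) → ∀ j, ![q i 5, q i 2, q i 0, q i 4, q i 1, 0, q i 3] j = w j := by
    intro i w h j
    have := eq_zero_of_forall_sum_eq_zero
      (![q i 5, q i 2, q i 0, q i 4, q i 1, 0, q i 3] - w) (fun t => by
        have := h t
        rw [eval_conicForm] at this
        simp [Fin.sum_univ_succ] at this ⊢
        linear_combination this) j
    exact sub_eq_zero.1 this
  -- If `deg F < 3`, the `t⁶` coefficients, that is, the coefficients of `y²`, vanish in all three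
  -- forms. Then the cusp would be a point of indeterminacy, which proper fixing excludes.
  have hF3 : F.coeff 3 ≠ 0 := by
    intro h3
    have h0 := co 0 ![F.coeff 0 * b, F.coeff 0 * a + F.coeff 1 * b, F.coeff 1 * a + F.coeff 2 * b,
      F.coeff 2 * a, 0, 0, 0] (fun t => by
        rw [hGt, hFt, h3]
        simp [Fin.sum_univ_succ]
        ring) 6
    have h2 := co 2 ![F.coeff 0, F.coeff 1, F.coeff 2, 0, 0, 0, 0] (fun t => by
        rw [hGt, hFt, h3]
        simp [Fin.sum_univ_succ]
        ring) 6
    have h1 := co 1 ![F.coeff 0 * b ^ 3, F.coeff 0 * (3 * a * b ^ 2) + F.coeff 1 * b ^ 3,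
      F.coeff 0 * (3 * a ^ 2 * b) + F.coeff 1 * (3 * a * b ^ 2) + F.coeff 2 * b ^ 3,
      F.coeff 0 * a ^ 3 + F.coeff 1 * (3 * a ^ 2 * b) + F.coeff 2 * (3 * a * b ^ 2),
      F.coeff 1 * a ^ 3 + F.coeff 2 * (3 * a ^ 2 * b), F.coeff 2 * a ^ 3, 0] (fun t => by
        rw [hGt, hFt, h3]
        simp [Fin.sum_univ_succ]
        ring) 6
    simp at h0 h1 h2
    have hv : M (Pi.single 1 1) ≠ 0 := by
      rw [Ne, M.map_eq_zero_iff]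
      exact fun h => by simpa using congrFun h 1
    obtain ⟨s, hs⟩ := Projectivization.exists_smul_eq_mk_rep ℂ (M (Pi.single 1 1)) hv
    set p : P2 := Projectivization.mk ℂ (M (Pi.single 1 1)) hv
    have hs' : p.rep = (s : ℂ) • M (Pi.single 1 1) := hs.symm
    have hpc : p ∈ curve c := by
      rw [hN.mem_curve, hs', map_smul, M.symm_apply_apply]
      simp [stdCubic]
    have hpi : p ∈ f.indet := by
      rw [indet, Set.mem_ofPred_eq, hs', evalTriple_smul f.fwd_hom]
      have : M.symm (evalTriple f.fwd (M (Pi.single 1 1))) = 0 := by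
        rw [← hG]
        ext i
        rw [hGq, eval_conicForm]
        fin_cases i <;> simp [h0, h1, h2]
      rw [M.symm.map_eq_zero_iff.1 this, smul_zero]
    have := (hN.mem_regPts hc p).1 (hf.indet_reg p hpc hpi)
    rw [hs', map_smul, M.symm_apply_apply] at this
    simp at this
  have hF3' : F.natDegree = 3 :=
    le_antisymm hdegF (Polynomial.le_natDegree_of_ne_zero hF3)
  obtain ⟨k, u, hk, hFu⟩ := exists_roots_of_natDegree_eq_three hF3'
  have co0 := co 0 ![-k * b * (u 0 * u 1 * u 2),
    k * (b * (u 0 * u 1 + u 0 * u 2 + u 1 * u 2) - a * (u 0 * u 1 * u 2)),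
    k * (a * (u 0 * u 1 + u 0 * u 2 + u 1 * u 2) - b * (u 0 + u 1 + u 2)),
    k * (b - a * (u 0 + u 1 + u 2)), k * a, 0, 0] (fun t => by
      rw [hGt, hFu]
      simp [Fin.sum_univ_succ]
      ring)
  have co1 := co 1 ![-k * b ^ 3 * (u 0 * u 1 * u 2),
    k * (b ^ 3 * (u 0 * u 1 + u 0 * u 2 + u 1 * u 2) - 3 * a * b ^ 2 * (u 0 * u 1 * u 2)),
    k * (-b ^ 3 * (u 0 + u 1 + u 2) + 3 * a * b ^ 2 * (u 0 * u 1 + u 0 * u 2 + u 1 * u 2)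
      - 3 * a ^ 2 * b * (u 0 * u 1 * u 2)),
    k * (b ^ 3 - 3 * a * b ^ 2 * (u 0 + u 1 + u 2) +
      3 * a ^ 2 * b * (u 0 * u 1 + u 0 * u 2 + u 1 * u 2) - a ^ 3 * (u 0 * u 1 * u 2)),
    k * (3 * a * b ^ 2 - 3 * a ^ 2 * b * (u 0 + u 1 + u 2) +
      a ^ 3 * (u 0 * u 1 + u 0 * u 2 + u 1 * u 2)),
    k * (3 * a ^ 2 * b - a ^ 3 * (u 0 + u 1 + u 2)), k * a ^ 3] (fun t => by
      rw [hGt, hFu]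
      simp [Fin.sum_univ_succ]
      ring)
  have co2 := co 2 ![-k * (u 0 * u 1 * u 2), k * (u 0 * u 1 + u 0 * u 2 + u 1 * u 2),
    -k * (u 0 + u 1 + u 2), k, 0, 0, 0] (fun t => by
      rw [hGt, hFu]
      simp [Fin.sum_univ_succ]
      ring)
  -- The missing `t⁵` term of `F(t) (a t + b)³`.
  have hb : b = a * (u 0 + u 1 + u 2) / 3 := by
    have := co1 5
    simp at this
    have h5 := this.resolve_left hk
    have : a ^ 2 * (3 * b - a * (u 0 + u 1 + u 2)) = 0 := by linear_combination h5
    rcases mul_eq_zero.1 this with h | h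
    · exact absurd h (pow_ne_zero 2 ha)
    · linear_combination h / 3
  refine ⟨a, k, u, ha, hk, fun v => ?_, fun p t hp => ?_⟩
  · have hlhs : evalTriple f.fwd (M v) = M (evalTriple G v) := by rw [hG, M.apply_symm_apply]
    rw [hlhs, ← map_smul]
    congr 1
    have a0 := co0 0
    have a1 := co0 1
    have a2 := co0 2
    have a3 := co0 3
    have a4 := co0 4
    have a6 := co0 6
    have b0 := co1 0
    have b1 := co1 1
    have b2 := co1 2
    have b3 := co1 3
    have b4 := co1 4
    have b6 := co1 6
    have c0 := co2 0
    have c1 := co2 1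
    have c2 := co2 2
    have c3 := co2 3
    have c4 := co2 4
    have c6 := co2 6
    simp at a0 a1 a2 a3 a4 a6 b0 b1 b2 b3 b4 b6 c0 c1 c2 c3 c4 c6
    refine vec_ext ?_ ?_ ?_
    · rw [hGq, eval_conicForm, a0, a1, a2, a3, a4, a6, hb]
      simp [evalTriple, modelTriple, eval_conicForm]
      ring
    · rw [hGq, eval_conicForm, b0, b1, b2, b3, b4, b6, hb]
      simp [evalTriple, modelTriple, eval_conicForm]
      ring
    · rw [hGq, eval_conicForm, c0, c1, c2, c3, c4, c6]
      simp [evalTriple, modelTriple, eval_conicForm]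
      ring
  · rw [← hb]
    exact hτP p t hp

/-- Parameters with sum 0 belong to collinear points, whose line `L` then divides all three forms of
the model, contrary to the absence of a common factor. -/
theorem HasModel.sum_ne_zero {a k : ℂ} {u : Fin 3 → ℂ} (h : f.HasModel M a k u) :
    u 0 + u 1 + u 2 ≠ 0 := by
  intro hσ
  have h2 : u 2 = -u 0 - u 1 := by linear_combination hσ
  let L : Poly := bind₁ (linTriple M.symm.toLinearMap)
    (X 1 + C (u 0 * u 1 + u 0 * u 2 + u 1 * u 2) * X 0 - C (u 0 * u 1 * u 2) * X 2)
  have hL : IsUnit L := by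
    refine f.fwd_prim L fun i => ⟨conjTriple M.toLinearMap
      ![C (k * a) * X 0, C (k * a ^ 3) * X 1, C k * X 2] M.symm.toLinearMap i, ?_⟩
    refine MvPolynomial.funext fun v => ?_
    have h1 := h (M.symm v)
    rw [M.apply_symm_apply] at h1
    change evalTriple f.fwd v i = _
    rw [map_mul]
    change _ = _ * evalTriple (conjTriple _ _ _) v i
    rw [evalTriple_conjTriple, eval_bind₁_triple, evalTriple_linTriple, LinearEquiv.coe_coe,
      LinearEquiv.coe_coe, ← smul_eq_mul, ← Pi.smul_apply, ← map_smul, h1, ← map_smul]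
    refine congrFun (congrArg M ?_) i
    generalize M.symm v = w
    refine vec_ext ?_ ?_ ?_ <;>
    · simp [evalTriple, modelTriple, eval_conicForm, h2]
      ring
  have h0 := hL.map (eval (0 : Vec))
  rw [eval_bind₁_triple, evalTriple_linTriple] at h0
  simp at h0

end QuadraticTransformation

/-! ### Symmetry of the model in its parameters. -/

theorem modelTriple_congr {u u' : Fin 3 → ℂ} (h₁ : u 0 + u 1 + u 2 = u' 0 + u' 1 + u' 2)
    (h₂ : u 0 * u 1 + u 0 * u 2 + u 1 * u 2 = u' 0 * u' 1 + u' 0 * u' 2 + u' 1 * u' 2)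
    (h₃ : u 0 * u 1 * u 2 = u' 0 * u' 1 * u' 2) : modelTriple u = modelTriple u' := by
  simp only [modelTriple, h₁, h₂, h₃]

theorem fin_three_cases {i j m : Fin 3} (hij : i ≠ j) (hjm : j ≠ m) (him : i ≠ m) :
    (i = 0 ∧ j = 1 ∧ m = 2) ∨ (i = 0 ∧ j = 2 ∧ m = 1) ∨ (i = 1 ∧ j = 0 ∧ m = 2) ∨
      (i = 1 ∧ j = 2 ∧ m = 0) ∨ (i = 2 ∧ j = 0 ∧ m = 1) ∨ (i = 2 ∧ j = 1 ∧ m = 0) := by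
  decide +revert

theorem fin_three_eq {i j m : Fin 3} (hij : i ≠ j) (hjm : j ≠ m) (him : i ≠ m) (x : Fin 3) :
    x = i ∨ x = j ∨ x = m := by
  decide +revert

theorem modelTriple_congr_of_ne {u u' : Fin 3 → ℂ} {i j m i' j' m' : Fin 3} (hij : i ≠ j)
    (hjm : j ≠ m) (him : i ≠ m) (hij' : i' ≠ j') (hjm' : j' ≠ m') (him' : i' ≠ m')
    (h₁ : u i = u' i') (h₂ : u j = u' j') (h₃ : u m = u' m') :
    modelTriple u = modelTriple u' := by
  rcases fin_three_cases hij hjm him with ⟨rfl, rfl, rfl⟩ | ⟨rfl, rfl, rfl⟩ | ⟨rfl, rfl, rfl⟩ |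
    ⟨rfl, rfl, rfl⟩ | ⟨rfl, rfl, rfl⟩ | ⟨rfl, rfl, rfl⟩ <;>
  rcases fin_three_cases hij' hjm' him' with ⟨rfl, rfl, rfl⟩ | ⟨rfl, rfl, rfl⟩ |
    ⟨rfl, rfl, rfl⟩ | ⟨rfl, rfl, rfl⟩ | ⟨rfl, rfl, rfl⟩ | ⟨rfl, rfl, rfl⟩ <;>
  refine modelTriple_congr ?_ ?_ ?_ <;> rw [h₁, h₂, h₃] <;> ring

theorem sum_eq_of_ne {u : Fin 3 → ℂ} {i j m : Fin 3} (hij : i ≠ j) (hjm : j ≠ m) (him : i ≠ m) :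
    u 0 + u 1 + u 2 = u i + u j + u m := by
  rcases fin_three_cases hij hjm him with ⟨rfl, rfl, rfl⟩ | ⟨rfl, rfl, rfl⟩ | ⟨rfl, rfl, rfl⟩ |
    ⟨rfl, rfl, rfl⟩ | ⟨rfl, rfl, rfl⟩ | ⟨rfl, rfl, rfl⟩ <;> ring

/-! ### Points of indeterminacy and exceptional lines of the model -/

theorem evalTriple_modelTriple_cuspVec (u : Fin 3 → ℂ) (t : ℂ) :
    evalTriple (modelTriple u) (cuspVec t) = ((t - u 0) * (t - u 1) * (t - u 2)) •
      cuspVec (t + (u 0 + u 1 + u 2) / 3) := by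
  refine vec_ext ?_ ?_ ?_ <;>
  · simp [evalTriple, modelTriple, eval_conicForm]
    ring

/-- The hypothesis says that a conic contains the line `y + m₀ x + m₂ z = 0`. On the curve the conic
restricts to `s(t)`, with roots `u`, times a linear factor, and the line restricts to `t³ + m₀ t +
m₂`. The quotient is linear with root `q`; since the `u` do not sum to 0, `q` must be some `u i`,
and cancelling it leaves the line through the other two points. -/
theorem modelTriple_factor {u : Fin 3 → ℂ} {a w : ℂ} (ha : a ≠ 0) (hσ : u 0 + u 1 + u 2 ≠ 0)
    {m₀ m₂ : ℂ} (h : ∀ x z, a * evalTriple (modelTriple u) ![x, -(m₀ * x + m₂ * z), z] 0 =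
      w * evalTriple (modelTriple u) ![x, -(m₀ * x + m₂ * z), z] 2) :
    ∃ i j m : Fin 3, i ≠ j ∧ j ≠ m ∧ i ≠ m ∧ w = a * u i - 2 * (a * (u 0 + u 1 + u 2) / 3) ∧
      ∀ t, t ^ 3 + m₀ * t + m₂ = (t - u j) * (t - u m) * (t + u j + u m) := by
  have e₁ := h 1 0
  have e₂ := h 0 1
  have e₃ := h 1 1
  simp [evalTriple, modelTriple, eval_conicForm] at e₁ e₂ e₃
  -- `q` is chosen so that `a (t + β) - w = a (t + 3 β - q)`, where `3 β` is the sum of the `u`; it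
  -- is the root of the complementary linear factor.
  set q := u 0 + u 1 + u 2 - (u 0 + u 1 + u 2) / 3 + w / a with hq
  have hw : w = a * (q - (u 0 + u 1 + u 2) + (u 0 + u 1 + u 2) / 3) := by
    rw [hq]
    field_simp
    ring
  clear_value q
  subst hw
  have key : ∀ t, (t - u 0) * (t - u 1) * (t - u 2) * (t + (u 0 + u 1 + u 2) - q) =
      (t ^ 3 + m₀ * t + m₂) * (t - q) := by
    intro t
    refine mul_left_cancel₀ ha ?_
    linear_combination t ^ 2 * e₁ + e₂ + t * (e₃ - e₁ - e₂)
  have hroot : (q - u 0) * (q - u 1) * (q - u 2) = 0 := by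
    have := key q
    rw [sub_self, mul_zero, add_sub_cancel_left] at this
    exact (mul_eq_zero.1 this).resolve_right hσ
  -- The difference of the two cubics has degree at most 1 in `t`, so its vanishing at the two
  -- points `q + 1` and `q + 2` suffices.
  have fin : ∀ x y : ℂ, (∀ t, (t ^ 3 + m₀ * t + m₂ - (t - x) * (t - y) * (t + x + y)) *
      (t - q) = 0) → ∀ t, t ^ 3 + m₀ * t + m₂ = (t - x) * (t - y) * (t + x + y) := by
    intro x y h t
    have h1 := h (q + 1)
    have h2 := h (q + 2)
    linear_combination (q + 2 - t) * h1 + (t - q - 1) / 2 * h2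
  rcases mul_eq_zero.1 hroot with hroot | hroot
  · rcases mul_eq_zero.1 hroot with hroot | hroot <;> rw [sub_eq_zero] at hroot <;> subst hroot
    · refine ⟨0, 1, 2, by decide, by decide, by decide, by ring, fin _ _ fun t => ?_⟩
      linear_combination -key t
    · refine ⟨1, 0, 2, by decide, by decide, by decide, by ring, fin _ _ fun t => ?_⟩
      linear_combination -key t
  · rw [sub_eq_zero] at hroot
    subst hroot
    refine ⟨2, 0, 1, by decide, by decide, by decide, by ring, fin _ _ fun t => ?_⟩
    linear_combination -key t

namespace QuadraticTransformation

variable {f : QuadraticTransformation} {M : Vec ≃ₗ[ℂ] Vec} {a k : ℂ} {u : Fin 3 → ℂ}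

theorem HasModel.param_mem_indet (h : f.HasModel M a k u) (hk : k ≠ 0) (t : ℂ) :
    param M t ∈ f.indet ↔ ∃ j, t = u j := by
  rw [indet, Set.mem_ofPred_eq, evalTriple_param_eq_zero_iff f.fwd_hom, h,
    evalTriple_modelTriple_cuspVec, map_smul, scaling_cuspVec, map_smul, smul_smul,
    smul_eq_zero_iff_left ((M.map_eq_zero_iff).not.2 (cuspVec_ne_zero _))]
  simp [hk, sub_eq_zero, Fin.exists_fin_succ, or_assoc]

theorem apply_rep_param_eq_zero_iff (ℓ : Module.Dual ℂ Vec) (t : ℂ) :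
    ℓ (param M t).rep = 0 ↔ ℓ (M (cuspVec t)) = 0 := by
  obtain ⟨s, hs, e⟩ := exists_rep_param M t
  rw [e, map_smul, smul_eq_zero_iff_right hs]

/-- Every line contracted to a smooth point of the cubic joins two of the three indeterminacy
parameters (or is tangent there), and its image is governed by the third. This is
`modelTriple_factor` applied to the line. -/
theorem HasModel.of_contracts (h : f.HasModel M a k u) (ha : a ≠ 0) (hk : k ≠ 0)
    {ℓ : Module.Dual ℂ Vec} {w : ℂ} (hℓ : f.Contracts ℓ (param M w)) :
    ∃ i j m : Fin 3, i ≠ j ∧ j ≠ m ∧ i ≠ m ∧ w = a * u i - 2 * (a * (u 0 + u 1 + u 2) / 3) ∧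
      ∀ t, ℓ (param M t).rep = 0 ↔ (t - u j) * (t - u m) * (t + u j + u m) = 0 := by
  obtain ⟨hℓ0, hc⟩ := hℓ
  set l : Fin 3 → ℂ := fun i => ℓ (M (Pi.single i 1)) with hl
  have hlv : ∀ v, ℓ (M v) = l 0 * v 0 + l 1 * v 1 + l 2 * v 2 := by
    intro v
    conv_lhs => rw [pi_eq_sum_univ' v]
    simp [Fin.sum_univ_three, hl, mul_comm]
  have hpt : ∀ v, ℓ (M v) = 0 → ∃ r : ℂ,
      scaling a (evalTriple (modelTriple u) v) = r • cuspVec w := by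
    intro v hv
    obtain ⟨s, hs⟩ := hc _ hv
    obtain ⟨s', -, hs'⟩ := exists_rep_param M w
    rw [h, hs', smul_smul] at hs
    refine ⟨k⁻¹ * (s * s'), M.injective ?_⟩
    rw [mul_smul, map_smul, map_smul, ← hs, smul_smul, inv_mul_cancel₀ hk, one_smul]
  have hrel : ∀ v, ℓ (M v) = 0 → a * evalTriple (modelTriple u) v 0 =
      w * evalTriple (modelTriple u) v 2 := by
    intro v hv
    obtain ⟨r, hr⟩ := hpt v hv
    have h0 := congrFun hr 0
    have h2 := congrFun hr 2
    simp at h0 h2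
    rw [h0, h2, mul_comm]
  -- Otherwise the line would pass through the cusp, which the model fixes, so it could not be
  -- contracted to a smooth point.
  have hl1 : l 1 ≠ 0 := by
    intro hl1
    obtain ⟨r, hr⟩ := hpt (Pi.single 1 1) (by rw [← hl1])
    have h1 := congrFun hr 1
    have h2 := congrFun hr 2
    simp [evalTriple, modelTriple, eval_conicForm] at h1 h2
    rw [← h2, zero_mul] at h1
    exact pow_ne_zero 3 ha h1
  obtain ⟨i, j, m, hij, hjm, him, hw, ht⟩ := modelTriple_factor (m₀ := l 0 / l 1)
    (m₂ := l 2 / l 1) (w := w) ha h.sum_ne_zero fun x z => hrel _ (by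
      rw [hlv]
      simp
      field_simp
      ring)
  refine ⟨i, j, m, hij, hjm, him, hw, fun t => ?_⟩
  have hfac : ℓ (M (cuspVec t)) = l 1 * (t ^ 3 + l 0 / l 1 * t + l 2 / l 1) := by
    rw [hlv, cuspVec_zero, cuspVec_one, cuspVec_two]
    field_simp
    ring
  rw [apply_rep_param_eq_zero_iff, ← ht, hfac, mul_eq_zero_iff_left hl1]

theorem HasModel.of_modelTriple_eq {u' : Fin 3 → ℂ} (h : f.HasModel M a k u)
    (hu : modelTriple u = modelTriple u') : f.HasModel M a k u' := fun v => by rw [h, hu]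

/-- The set `I(f)` does not record multiplicities or the pairing with `I(f⁻¹)`; the contracted lines
do. In each kind of indexing they show that the given list has the same multiset as the roots `u`
and pair `p j` with `r j`. -/
theorem HasModel.of_isIndexing (h : f.HasModel M a k u) (ha : a ≠ 0) (hk : k ≠ 0)
    {pPlus pMinus : Fin 3 → P2} (hI : f.IsIndexing pPlus pMinus) {p r : Fin 3 → ℂ}
    (hp : ∀ j, pPlus j = param M (p j)) (hr : ∀ j, pMinus j = param M (r j)) :
    f.HasModel M a k p ∧ ∀ j, r j = a * p j - 2 * (a * (p 0 + p 1 + p 2) / 3) := by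
  obtain rfl : pPlus = fun j => param M (p j) := funext hp
  obtain rfl : pMinus = fun j => param M (r j) := funext hr
  obtain ⟨hind, -, hI⟩ := hI
  have hpu : ∀ j, ∃ i, p j = u i := fun j => by
    rw [← h.param_mem_indet hk, hind]
    exact ⟨j, rfl⟩
  have hup : ∀ i, ∃ j, u i = p j := fun i => by
    have := (h.param_mem_indet hk (u i)).2 ⟨i, rfl⟩
    rw [hind] at this
    obtain ⟨j, hj⟩ := this
    exact ⟨j, (param_injective M hj).symm⟩
  rcases hI with ⟨hinj, hlines⟩ | ⟨i, j, l, hij, hjl, hil, heq, hne, heq', ⟨ℓ₁, h₁i, h₁l, h₁c⟩,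
    ⟨ℓ₂, h₂i, h₂l, h₂c⟩⟩ | ⟨hp', hr', ℓ, -, hc⟩
  · have hpi : Function.Injective p := fun x y hxy => hinj (congrArg (param M) hxy)
    choose e he using hpu
    have hei : Function.Injective e := fun x y hxy => hpi (by rw [he, he, hxy])
    have hm : f.HasModel M a k p := h.of_modelTriple_eq
      (modelTriple_congr_of_ne (hei.ne (by decide : (0 : Fin 3) ≠ 1))
        (hei.ne (by decide : (1 : Fin 3) ≠ 2)) (hei.ne (by decide : (0 : Fin 3) ≠ 2))
        (by decide) (by decide) (by decide) (he 0).symm (he 1).symm (he 2).symm)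
    refine ⟨hm, fun l => ?_⟩
    obtain ⟨ℓ, hv, hc⟩ := hlines l
    obtain ⟨i, j, m, hij, hjm, him, hw, ht⟩ := hm.of_contracts ha hk hc
    by_cases hil : i = l
    · rw [← hil] at hw ⊢
      exact hw
    · exfalso
      have := (ht (p i)).1 (hv i hil)
      have hs := hm.sum_ne_zero
      rw [sum_eq_of_ne hij hjm him] at hs
      simp [sub_eq_zero, hpi.eq_iff, hij, him, hs] at this
  · have hpij : p i = p j := param_injective M heq
    have hpil : p i ≠ p l := fun h => hne (congrArg (param M) h)
    have hrij : r i = r j := param_injective M heq'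
    -- The exceptional line avoiding `p l` has two of the `u` on it, both necessarily equal to `p
    -- i`. So `p i` is the double root, and `p l`, the simple one, determines the image.
    have hm : f.HasModel M a k p ∧ r l = a * p l - 2 * (a * (p 0 + p 1 + p 2) / 3) := by
      obtain ⟨i', j', m', hij', hjm', him', hw, ht⟩ := h.of_contracts ha hk h₂c
      have hval : ∀ x, u x = p i ∨ u x = p l := by
        intro x
        obtain ⟨y, hy⟩ := hup x
        rcases fin_three_eq hij hjl hil y with rfl | rfl | rfl
        · exact Or.inl hy
        · exact Or.inl (hy.trans hpij.symm)
        · exact Or.inr hy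
      have hl : (p l - u j') * (p l - u m') * (p l + u j' + u m') ≠ 0 := by
        rw [Ne, ← ht]
        exact h₂l
      have hj' : u j' = p i := by
        refine (hval j').resolve_right fun h => hl ?_
        rw [h]
        ring
      have hm' : u m' = p i := by
        refine (hval m').resolve_right fun h => hl ?_
        rw [h]
        ring
      have hi' : u i' = p l := by
        obtain ⟨y, hy⟩ := hpu l
        rcases fin_three_eq hij' hjm' him' y with rfl | rfl | rfl
        · exact hy.symm
        · exact absurd (hj'.symm.trans hy.symm) hpil
        · exact absurd (hm'.symm.trans hy.symm) hpil
      refine ⟨h.of_modelTriple_eq (modelTriple_congr_of_ne hij' hjm' him' hil.symm hij hjl.symm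
        hi' hj' (hm'.trans hpij)), ?_⟩
      rw [hw, sum_eq_of_ne hij' hjm' him', sum_eq_of_ne hil.symm hij hjl.symm, hi', hj', hm', hpij]
    obtain ⟨hm, hrl⟩ := hm
    have hrj : r j = a * p j - 2 * (a * (p 0 + p 1 + p 2) / 3) := by
      obtain ⟨i', j', m', hij', hjm', him', hw, ht⟩ := hm.of_contracts ha hk h₁c
      have hl := (ht (p l)).1 h₁l
      have hi' : i' ≠ l := by
        rintro rfl
        have hval : ∀ x, x ≠ i' → p x = p i := by
          intro x hx
          rcases fin_three_eq hij hjl hil x with rfl | rfl | rfl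
          · rfl
          · exact hpij.symm
          · exact absurd rfl hx
        have hs := hm.sum_ne_zero
        rw [sum_eq_of_ne hij' hjm' him'] at hs
        rw [hval j' hij'.symm, hval m' him'.symm] at hl hs
        simp [sub_eq_zero, hpil.symm, hs] at hl
      rw [hw]
      rcases fin_three_eq hij hjl hil i' with rfl | rfl | rfl
      · rw [hpij]
      · rfl
      · exact absurd rfl hi'
    refine ⟨hm, fun x => ?_⟩
    rcases fin_three_eq hij hjl hil x with rfl | rfl | rfl
    · rw [hrij, hrj, hpij]
    · exact hrj
    · exact hrl
  · have hpc : ∀ x y, p x = p y := fun x y => param_injective M (hp' x y)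
    have hrc : ∀ x y, r x = r y := fun x y => param_injective M (hr' x y)
    have huc : ∀ x y, u x = p y := fun x y => by
      obtain ⟨z, hz⟩ := hup x
      rw [hz, hpc]
    have hup' : u = p := funext fun x => huc x x
    subst hup'
    obtain ⟨i', j', m', -, -, -, hw, -⟩ := h.of_contracts ha hk hc
    refine ⟨h, fun x => ?_⟩
    rw [hrc x 0, hw, hpc i' x]

end QuadraticTransformation

/-! ### The characteristic polynomial of orbit data -/

section charPoly

variable {n : Fin 3 → ℕ} {σ : Equiv.Perm (Fin 3)}

theorem vecH_none : vecH n none = 1 := by simp [vecH]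

theorem vecH_some (x : (i : Fin 3) × Fin (n i)) : vecH n (some x) = 0 := by simp [vecH]

theorem vecE_none (i : Fin 3) (m : ℕ) : vecE n i m none = 0 := by
  rw [vecE]
  split_ifs <;> simp

theorem vecE_some (i : Fin 3) (m : ℕ) (j : Fin 3) (l : Fin (n j)) :
    vecE n i m (some ⟨j, l⟩) = if j = i ∧ (l : ℕ) = m then 1 else 0 := by
  rw [vecE]
  by_cases hji : j = i
  · subst hji
    by_cases h : m < n j
    · simp [h, Pi.single_apply, Fin.ext_iff]
    · have : (l : ℕ) ≠ m := fun h' => h (h' ▸ l.2)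
      simp [h, this]
  · split_ifs <;> simp_all

theorem matQ_none_none : matQ n none none = 2 := by
  simp [matQ, vecH_none, vecE_none]

theorem matQ_none_some (i : Fin 3) (m : Fin (n i)) :
    matQ n none (some ⟨i, m⟩) = if (m : ℕ) = 0 then 1 else 0 := by
  simp only [matQ, Matrix.of_apply]
  split_ifs <;> simp [vecH_none, vecE_none]

theorem matQ_some_none (j : Fin 3) (l : Fin (n j)) :
    matQ n (some ⟨j, l⟩) none = if (l : ℕ) = 0 then -1 else 0 := by
  simp only [matQ, Matrix.of_apply]
  simp [vecH_some, vecE_some, ite_and]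
  split_ifs <;> rfl

theorem matQ_some_some (j : Fin 3) (l : Fin (n j)) (i : Fin 3) (m : Fin (n i)) :
    matQ n (some ⟨j, l⟩) (some ⟨i, m⟩) =
      if (m : ℕ) = 0 then (if (l : ℕ) = 0 ∧ j ≠ i then -1 else 0)
      else if j = i ∧ (l : ℕ) = m then 1 else 0 := by
  simp only [matQ, Matrix.of_apply]
  by_cases hm : (m : ℕ) = 0
  · simp only [hm, if_true, Pi.sub_apply, vecH_some, Finset.sum_apply, vecE_some]
    by_cases hl : (l : ℕ) = 0 <;> by_cases hji : j = i <;> simp [hl, hji]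
  · simp only [hm, if_false, vecE_some]

theorem matS_none_none : matS n σ none none = 1 := by simp [matS, vecH_none]

theorem matS_none_some (x : (i : Fin 3) × Fin (n i)) : matS n σ none (some x) = 0 := by
  simp only [matS, Matrix.of_apply]
  split_ifs <;> simp [vecE_none]

theorem matS_some_none (x : (i : Fin 3) × Fin (n i)) : matS n σ (some x) none = 0 := by
  simp [matS, vecH_some]

theorem matS_some_some (j : Fin 3) (l : Fin (n j)) (i : Fin 3) (m : Fin (n i)) :
    matS n σ (some ⟨j, l⟩) (some ⟨i, m⟩) =
      if (m : ℕ) = 0 then (if i = σ j ∧ (l : ℕ) = n j - 1 then 1 else 0)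
      else if j = i ∧ (l : ℕ) = m - 1 then 1 else 0 := by
  simp only [matS, Matrix.of_apply]
  by_cases hm : (m : ℕ) = 0
  · simp only [hm, if_true, vecE_some]
    by_cases hji : j = σ.symm i
    · subst hji
      simp
    · have : i ≠ σ j := fun h => hji (by rw [h, σ.symm_apply_apply])
      simp [hji, this]
  · simp only [hm, if_false, vecE_some]

/-- The matrix of the orbit data acting on complex vectors. -/
noncomputable def orbitMap (n : Fin 3 → ℕ) (σ : Equiv.Perm (Fin 3)) (v : Idx n → ℂ) : Idx n → ℂ :=
  ((matS n σ * matQ n).map (Int.cast : ℤ → ℂ)).mulVec v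

theorem aeval_charPoly_eq_zero_iff_exists (a : ℂ) : Polynomial.aeval a (charPoly n σ) = 0 ↔
    ∃ v, v ≠ 0 ∧ orbitMap n σ v = a • v := by
  have h : Polynomial.aeval a (charPoly n σ) = (Matrix.scalar (Idx n) a -
      (matS n σ * matQ n).map (Int.cast : ℤ → ℂ)).det := by
    rw [← Matrix.eval_charpoly, charPoly, Polynomial.aeval_def, ← Polynomial.eval_map]
    have := Matrix.charpoly_map (matS n σ * matQ n) (Int.castRingHom ℂ)
    rw [algebraMap_int_eq, ← this]
    rfl
  rw [h, ← Matrix.exists_mulVec_eq_zero_iff]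
  refine exists_congr fun v => and_congr_right fun _ => ?_
  rw [Matrix.sub_mulVec, sub_eq_zero, orbitMap, eq_comm, Matrix.scalar_apply,
    ← Matrix.smul_one_eq_diagonal, Matrix.smul_mulVec, Matrix.one_mulVec]

/-- The map `Q` on complex vectors. -/
noncomputable def actQ (n : Fin 3 → ℕ) (v : Idx n → ℂ) : Idx n → ℂ :=
  ((matQ n).map (Int.cast : ℤ → ℂ)).mulVec v

theorem actQ_apply (v : Idx n → ℂ) (x : Idx n) :
    actQ n v x = (matQ n x none : ℂ) * v none +
      ∑ i, ∑ m : Fin (n i), (matQ n x (some ⟨i, m⟩) : ℂ) * v (some ⟨i, m⟩) := by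
  rw [actQ, Matrix.mulVec, dotProduct, Fintype.sum_option, Fintype.sum_sigma]
  rfl

theorem orbitMap_eq (v : Idx n → ℂ) :
    orbitMap n σ v = ((matS n σ).map (Int.cast : ℤ → ℂ)).mulVec (actQ n v) := by
  rw [actQ, Matrix.mulVec_mulVec, orbitMap]
  congr 1
  exact Matrix.map_mul (f := Int.castRingHom ℂ)

theorem orbitMap_none (v : Idx n → ℂ) : orbitMap n σ v none = actQ n v none := by
  rw [orbitMap_eq, Matrix.mulVec, dotProduct, Fintype.sum_option]
  simp [matS_none_none, matS_none_some]

theorem orbitMap_last (hn : ∀ j, 1 ≤ n j) (v : Idx n → ℂ) (j : Fin 3) (l : Fin (n j))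
    (hl : (l : ℕ) = n j - 1) :
    orbitMap n σ v (some ⟨j, l⟩) = actQ n v (some ⟨σ j, ⟨0, hn _⟩⟩) := by
  rw [orbitMap_eq, Matrix.mulVec, dotProduct, Finset.sum_eq_single (some ⟨σ j, ⟨0, hn _⟩⟩)]
  · simp [matS_some_some, hl]
  · rintro (_ | ⟨i, m⟩) - hx
    · simp [matS_some_none]
    · rw [Matrix.map_apply, matS_some_some]
      split_ifs with h1 h2 h2
      · obtain ⟨rfl, -⟩ := h2
        exact absurd (by rw [show m = ⟨0, hn _⟩ from Fin.ext h1]) hx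
      · simp
      · obtain ⟨rfl, h2⟩ := h2
        have := m.2
        omega
      · simp
  · simp

theorem orbitMap_succ (v : Idx n → ℂ) (j : Fin 3) (l : ℕ) (hl : l + 1 < n j) :
    orbitMap n σ v (some ⟨j, ⟨l, by omega⟩⟩) = actQ n v (some ⟨j, ⟨l + 1, hl⟩⟩) := by
  rw [orbitMap_eq, Matrix.mulVec, dotProduct, Finset.sum_eq_single (some ⟨j, ⟨l + 1, hl⟩⟩)]
  · simp [matS_some_some]
  · rintro (_ | ⟨i, m⟩) - hx
    · simp [matS_some_none]
    · rw [Matrix.map_apply, matS_some_some]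
      split_ifs with h1 h2 h2
      · obtain ⟨rfl, h2⟩ := h2
        simp at h2
        omega
      · simp
      · obtain ⟨rfl, h2⟩ := h2
        refine absurd ?_ hx
        simp at h2
        congr
        ext
        simp
        omega
      · simp
  · simp

theorem sum_mul_eq_single_zero {N : ℕ} (hN : 1 ≤ N) (w : Fin N → ℂ) (g : Fin N → ℂ)
    (hg : ∀ m : Fin N, (m : ℕ) ≠ 0 → g m = 0) : ∑ m, g m * w m = g ⟨0, hN⟩ * w ⟨0, hN⟩ := by
  refine Finset.sum_eq_single _ (fun m _ hm => ?_) (by simp)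
  rw [hg m fun h => hm (Fin.ext h), zero_mul]

theorem actQ_none (hn : ∀ j, 1 ≤ n j) (v : Idx n → ℂ) :
    actQ n v none = 2 * v none + ∑ i, v (some ⟨i, ⟨0, hn i⟩⟩) := by
  rw [actQ_apply, matQ_none_none, Int.cast_ofNat, add_right_inj]
  refine Finset.sum_congr rfl fun i _ => ?_
  rw [sum_mul_eq_single_zero (hn i) (fun m => v (some ⟨i, m⟩))]
  · simp [matQ_none_some]
  · intro m hm
    simp [matQ_none_some, hm]

theorem actQ_zero (hn : ∀ j, 1 ≤ n j) (v : Idx n → ℂ) (j : Fin 3) :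
    actQ n v (some ⟨j, ⟨0, hn j⟩⟩) = -v none - ∑ i, v (some ⟨i, ⟨0, hn i⟩⟩) +
      v (some ⟨j, ⟨0, hn j⟩⟩) := by
  have h : ∀ i, ∑ m : Fin (n i), (matQ n (some ⟨j, ⟨0, hn j⟩⟩) (some ⟨i, m⟩) : ℂ) *
      v (some ⟨i, m⟩) = -v (some ⟨i, ⟨0, hn i⟩⟩) +
        if j = i then v (some ⟨i, ⟨0, hn i⟩⟩) else 0 := by
    intro i
    rw [sum_mul_eq_single_zero (hn i) (fun m => v (some ⟨i, m⟩))]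
    · by_cases hji : j = i <;> simp [matQ_some_some, hji]
    · intro m hm
      simp [matQ_some_some, hm, Ne.symm hm]
  rw [actQ_apply, matQ_some_none]
  simp only [h, Finset.sum_add_distrib, Finset.sum_neg_distrib, Finset.sum_ite_eq,
    Finset.mem_univ, if_true]
  push_cast
  ring

theorem actQ_succ (v : Idx n → ℂ) (j : Fin 3) (l : Fin (n j)) (hl : (l : ℕ) ≠ 0) :
    actQ n v (some ⟨j, l⟩) = v (some ⟨j, l⟩) := by
  rw [actQ, Matrix.mulVec, dotProduct, Finset.sum_eq_single (some ⟨j, l⟩)]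
  · simp [matQ_some_some, hl]
  · rintro (_ | ⟨i, m⟩) - hx
    · simp [matQ_some_none, hl]
    · rw [Matrix.map_apply, matQ_some_some]
      split_ifs with h1 h2 h2
      · exact absurd h2.1 hl
      · simp
      · obtain ⟨rfl, h2⟩ := h2
        exact absurd (by rw [Fin.ext h2]) hx
      · simp
  · simp

/-- Along each chain `E_{j,0}, …, E_{j,n_j-1}` an eigenvector grows geometrically, so `h` on `H` and
`x j` on `E_{j,0}` determine it. What remains is the `H` coordinate, which is the sum relation, and
the end of each chain, which gives the recursion once that relation is used to eliminate the sum. -/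
theorem aeval_charPoly_eq_zero_iff (hn : ∀ j, 1 ≤ n j) (a : ℂ) :
    Polynomial.aeval a (charPoly n σ) = 0 ↔
      ∃ (h : ℂ) (x : Fin 3 → ℂ), (h ≠ 0 ∨ x ≠ 0) ∧ x 0 + x 1 + x 2 = (a - 2) * h ∧
        ∀ j, x (σ j) = a ^ n j * x j + (a - 1) * h := by
  rw [aeval_charPoly_eq_zero_iff_exists]
  constructor
  · rintro ⟨v, hv, he⟩
    have hpow : ∀ j (m : ℕ) (hm : m < n j),
        v (some ⟨j, ⟨m, hm⟩⟩) = a ^ m * v (some ⟨j, ⟨0, hn j⟩⟩) := by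
      intro j m
      induction m with
      | zero => simp
      | succ m ih =>
        intro hm
        have h1 := congrFun he (some ⟨j, ⟨m, by omega⟩⟩)
        rw [orbitMap_succ v j m hm, actQ_succ _ _ _ (by simp), Pi.smul_apply, ih (by omega)] at h1
        rw [h1, smul_eq_mul]
        ring
    have hnone := congrFun he none
    rw [orbitMap_none, actQ_none hn, Pi.smul_apply, smul_eq_mul, Fin.sum_univ_three] at hnone
    refine ⟨v none, fun j => v (some ⟨j, ⟨0, hn j⟩⟩), ?_, by linear_combination hnone, ?_⟩
    · by_contra! h
      refine hv (funext ?_)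
      rintro (_ | ⟨i, m⟩)
      · exact h.1
      · rw [hpow, congrFun h.2 i]
        simp
    · intro j
      have h1 := congrFun he (some ⟨j, ⟨n j - 1, by have := hn j; omega⟩⟩)
      rw [orbitMap_last hn v j _ rfl, actQ_zero hn, Pi.smul_apply, hpow j (n j - 1), smul_eq_mul,
        Fin.sum_univ_three, ← mul_assoc, ← pow_succ', Nat.sub_add_cancel (hn j)] at h1
      linear_combination h1 + hnone
  · rintro ⟨h, x, hne, hsum, hx⟩
    let v : Idx n → ℂ := fun y => match y with
      | none => h
      | some ⟨i, m⟩ => a ^ (m : ℕ) * x i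
    have hv0 : v none = h := rfl
    have hvs : ∀ i m, v (some ⟨i, m⟩) = a ^ (m : ℕ) * x i := fun _ _ => rfl
    refine ⟨v, ?_, ?_⟩
    · intro hv
      rcases hne with hne | hne
      · exact hne (congrFun hv none)
      · refine hne (funext fun i => ?_)
        have := congrFun hv (some ⟨i, ⟨0, hn i⟩⟩)
        simpa [hvs] using this
    · ext y
      rcases y with _ | ⟨j, l⟩
      · rw [orbitMap_none, actQ_none hn, Fin.sum_univ_three, Pi.smul_apply, smul_eq_mul]
        simp only [hvs, hv0]
        linear_combination hsum
      · by_cases hl : (l : ℕ) = n j - 1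
        · rw [orbitMap_last hn v j l hl, actQ_zero hn, Fin.sum_univ_three, Pi.smul_apply,
            smul_eq_mul]
          simp only [hvs, hv0]
          rw [hx, ← mul_assoc, ← pow_succ', hl, Nat.sub_add_cancel (hn j)]
          linear_combination -hsum
        · have hl' : (l : ℕ) + 1 < n j := by
            have := l.2
            omega
          have : orbitMap n σ v (some ⟨j, l⟩) = _ := orbitMap_succ v j l hl'
          rw [this, actQ_succ _ _ _ (by simp), Pi.smul_apply, smul_eq_mul, hvs, hvs]
          ring

/-- Composing the recursion once round the cycle of `σ` through `j` gives a linear equation for `x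
j`. Its leading coefficient `1 - a^N`, with `N` the total length of the cycle, is nonzero because
`a` is not a root of unity. -/
theorem eq_baseValue {a h : ℂ} (ha : ∀ m : ℕ, 0 < m → a ^ m ≠ 1) (hn : ∀ j, 1 ≤ n j)
    {x : Fin 3 → ℂ} (hx : ∀ j, x (σ j) = a ^ n j * x j + (a - 1) * h) (j : Fin 3) :
    x j = baseValue n σ a j * h := by
  have hne : ∀ m : ℕ, 1 ≤ m → 1 - a ^ m ≠ 0 := fun m hm =>
    sub_ne_zero.2 (ha m hm).symm
  rw [baseValue]
  split_ifs with h1 h2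
  · have e1 := hx j
    rw [h1] at e1
    rw [div_mul_eq_mul_div, eq_div_iff (hne _ (hn j))]
    linear_combination e1
  · have e1 := hx j
    have e2 := hx (σ j)
    rw [h2] at e2
    rw [div_mul_eq_mul_div, eq_div_iff (hne _ (by have := hn j; omega)), pow_add]
    linear_combination e2 + a ^ n (σ j) * e1
  · have h3 : σ (σ (σ j)) = j := by
      have : ∀ σ : Equiv.Perm (Fin 3), ∀ j, σ j ≠ j → σ (σ j) ≠ j → σ (σ (σ j)) = j := by decide
      exact this σ j h1 h2
    have e1 := hx j
    have e2 := hx (σ j)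
    have e3 := hx (σ (σ j))
    rw [h3] at e3
    rw [div_mul_eq_mul_div, eq_div_iff (hne _ (by have := hn j; omega)), pow_add, pow_add, pow_add]
    linear_combination e3 + a ^ n (σ (σ j)) * e2 + a ^ n (σ (σ j)) * a ^ n (σ j) * e1

end charPoly

/-! ### Linear automorphisms preserving the cubic. -/

theorem exists_rep_act (T : Vec ≃ₗ[ℂ] Vec) (p : P2) :
    ∃ s : ℂ, s ≠ 0 ∧ (act T p).rep = s • T p.rep := by
  have h : act T p = Projectivization.mk ℂ (T p.rep)
      (fun h => p.rep_nonzero (T.map_eq_zero_iff.1 h)) := by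
    conv_lhs => rw [← p.mk_rep]
    rfl
  rw [h]
  obtain ⟨a, ha⟩ := Projectivization.exists_smul_eq_mk_rep ℂ (T p.rep)
    (fun h => p.rep_nonzero (T.map_eq_zero_iff.1 h))
  exact ⟨a, a.ne_zero, ha.symm⟩

theorem act_trans (S T : Vec ≃ₗ[ℂ] Vec) (p : P2) : act (S.trans T) p = act T (act S p) := by
  induction p using Projectivization.ind with
  | h v hv => rfl

theorem act_refl (p : P2) : act (LinearEquiv.refl ℂ Vec) p = p := by
  induction p using Projectivization.ind with
  | h v hv => rfl

theorem stdCubic_smul (s : ℂ) (v : Vec) : stdCubic (s • v) = s ^ 3 * stdCubic v := by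
  simp [stdCubic]
  ring

theorem HasNormalForm.act_image_curve {c : Poly} {M M' : Vec ≃ₗ[ℂ] Vec} (h : HasNormalForm c M)
    (h' : HasNormalForm c M') : act (M.symm.trans M') '' curve c = curve c := by
  have key : ∀ p, act (M.symm.trans M') p ∈ curve c ↔ p ∈ curve c := by
    intro p
    obtain ⟨s, hs, e⟩ := exists_rep_act (M.symm.trans M') p
    rw [h'.mem_curve, h.mem_curve, e, map_smul, stdCubic_smul]
    simp [hs]
  ext q
  constructor
  · rintro ⟨p, hp, rfl⟩
    exact (key p).2 hp
  · intro hq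
    have e : act (M.symm.trans M') (act (M'.symm.trans M) q) = q := by
      rw [← act_trans]
      convert act_refl q
      ext v : 1
      simp
    exact ⟨_, (key _).1 (by rwa [e]), e⟩

/-- The linear automorphism `diag(a, a³, 1)`. -/
noncomputable def scalingEquiv (a : ℂ) (ha : a ≠ 0) : Vec ≃ₗ[ℂ] Vec :=
  linEquivOfInjective (scaling a) fun v hv => by
    have h0 := congrFun hv 0
    have h1 := congrFun hv 1
    have h2 := congrFun hv 2
    simp [ha] at h0 h1 h2
    exact vec_ext h0 h1 h2

theorem scalingEquiv_apply (a : ℂ) (ha : a ≠ 0) (v : Vec) :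
    scalingEquiv a ha v = scaling a v := rfl

theorem HasNormalForm.scale {c : Poly} {M : Vec ≃ₗ[ℂ] Vec} (h : HasNormalForm c M) {a : ℂ}
    (ha : a ≠ 0) : HasNormalForm c ((scalingEquiv a ha).trans M) := by
  obtain ⟨k, hk, h⟩ := h
  refine ⟨k * a ^ 3, mul_ne_zero hk (pow_ne_zero 3 ha), fun v => ?_⟩
  rw [LinearEquiv.trans_apply, h, scalingEquiv_apply, stdCubic, stdCubic]
  simp
  ring

theorem param_scale (M : Vec ≃ₗ[ℂ] Vec) {a : ℂ} (ha : a ≠ 0) (t : ℂ) :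
    param ((scalingEquiv a ha).trans M) t = param M (a * t) := by
  rw [param_eq_mk, param_eq_mk]
  congr 1
  rw [LinearEquiv.trans_apply, scalingEquiv_apply, scaling_cuspVec]

/-! ### Tentative realizations in coordinates. -/

namespace QuadraticTransformation

variable {f : QuadraticTransformation} {c : Poly} {M : Vec ≃ₗ[ℂ] Vec} {a a' k k' b : ℂ}
  {u u' : Fin 3 → ℂ} {n : Fin 3 → ℕ} {σ : Equiv.Perm (Fin 3)} {pPlus pMinus : Fin 3 → P2}

/-- The coefficient of `y z` in the third form is `k`. The coefficients of `x y` and `y z` in the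
first are `k a` and `-2/3 · k a` times the sum of the parameters. Differences of values at the
chosen vectors isolate them. -/
theorem HasModel.unique (h : f.HasModel M a k u) (h' : f.HasModel M a' k' u') (ha : a ≠ 0)
    (hk : k ≠ 0) : a = a' ∧ u 0 + u 1 + u 2 = u' 0 + u' 1 + u' 2 := by
  have key : ∀ v i, (k • scaling a (evalTriple (modelTriple u) v)) i =
      (k' • scaling a' (evalTriple (modelTriple u') v)) i := by
    intro v i
    refine congrFun (M.injective ?_) i
    rw [M.map_smul, M.map_smul]
    exact (h v).symm.trans (h' v)
  have e₁ := key ![0, 1, 1] 2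
  have e₂ := key ![0, 0, 1] 2
  have e₃ := key ![1, 1, 0] 0
  have e₄ := key ![1, 0, 0] 0
  have e₅ := key ![0, 1, 1] 0
  have e₆ := key ![0, 0, 1] 0
  simp [evalTriple, modelTriple, eval_conicForm] at e₁ e₂ e₃ e₄ e₅ e₆
  have hk' : k = k' := by linear_combination e₁ + e₂
  subst hk'
  have ha' : a = a' := mul_left_cancel₀ hk (by linear_combination e₃ - e₄)
  subst ha'
  refine ⟨rfl, mul_left_cancel₀ (mul_ne_zero hk ha) ?_⟩
  linear_combination (-3 / 2) * (e₅ + e₆)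

theorem IsRestriction.apply_param (hc : c.IsHomogeneous 3) (hN : HasNormalForm c M)
    (hf : f.ProperlyFixes c) {τ : regPts c → regPts c} (hτ : f.IsRestriction c τ)
    (h : f.HasModel M a k u) (ha : a ≠ 0) (hk : k ≠ 0) (p : regPts c) (t : ℂ)
    (hp : (p : P2) = param M t) :
    (τ p : P2) = param M (a * t + a * (u 0 + u 1 + u 2) / 3) := by
  obtain ⟨a', k', u', -, -, h', hτ'⟩ := exists_model hc hN hf hτ
  obtain ⟨rfl, hu⟩ := h.unique h' ha hk
  rw [hu]
  exact hτ' p t hp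

theorem ActsBy.eq_model (hc : c.IsHomogeneous 3) (hN : HasNormalForm c M)
    (hf : f.ProperlyFixes c) (hact : f.ActsBy c M a' b) (h : f.HasModel M a k u) (ha : a ≠ 0)
    (hk : k ≠ 0) : a' = a ∧ b = a * (u 0 + u 1 + u 2) / 3 := by
  obtain ⟨τ, hτ, hact⟩ := hact
  have key : ∀ t, a' * t + b = a * t + a * (u 0 + u 1 + u 2) / 3 := by
    intro t
    have hreg : param M t ∈ regPts c := by
      rw [← hN.isAdapted hc]
      exact ⟨t, rfl⟩
    refine param_injective M ?_
    rw [← hact ⟨_, hreg⟩ t rfl, hτ.apply_param hc hN hf h ha hk ⟨_, hreg⟩ t rfl]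
  have h0 := key 0
  have h1 := key 1
  constructor
  · linear_combination h1 - h0
  · linear_combination h0

/-- The orbit condition is the formula for iterating an affine map. It is multiplied through by `1 -
a`, so that the case `a = 1` is included. -/
theorem TentativelyRealizes.exists_coordinates (hc : c.IsHomogeneous 3) (hN : HasNormalForm c M)
    (h : f.TentativelyRealizes c n σ pPlus pMinus) :
    ∃ (a k : ℂ) (p r : Fin 3 → ℂ), a ≠ 0 ∧ k ≠ 0 ∧ f.HasModel M a k p ∧ (∀ j, pPlus j = param M (p j)) ∧
      (∀ j, pMinus j = param M (r j)) ∧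
      (∀ j, r j = a * p j - 2 * (a * (p 0 + p 1 + p 2) / 3)) ∧
      ∀ j, (1 - a) * p (σ j) = a ^ (n j - 1) * ((1 - a) * r j) +
        a * (p 0 + p 1 + p 2) / 3 * (1 - a ^ (n j - 1)) := by
  obtain ⟨hf, hI, τ, hτ, horb⟩ := h
  obtain ⟨a, k, u, ha, hk, hm, -⟩ := exists_model hc hN hf hτ
  choose x hx hxp using horb
  have hr : ∀ j, ∃ t, pMinus j = param M t := fun j => by
    obtain ⟨t, ht⟩ := (hN.isAdapted hc).ge (x j).2
    exact ⟨t, by rw [ht, hx]⟩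
  have hp : ∀ j, ∃ t, pPlus j = param M t := fun j => by
    obtain ⟨t, ht⟩ := (hN.isAdapted hc).ge (τ^[n (σ.symm j) - 1] (x (σ.symm j))).2
    exact ⟨t, by rw [ht, hxp, σ.apply_symm_apply]⟩
  choose r hr using hr
  choose p hp using hp
  obtain ⟨hmp, hrel⟩ := hm.of_isIndexing ha hk hI hp hr
  refine ⟨a, k, p, r, ha, hk, hmp, hp, hr, hrel, fun j => ?_⟩
  have hiter : ∀ m : ℕ, ∃ t, (τ^[m] (x j) : P2) = param M t ∧
      (1 - a) * t = a ^ m * ((1 - a) * r j) + a * (p 0 + p 1 + p 2) / 3 * (1 - a ^ m) := by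
    intro m
    induction m with
    | zero => exact ⟨r j, by rw [← hr, ← hx]; rfl, by ring⟩
    | succ m ih =>
      obtain ⟨t, ht, hte⟩ := ih
      refine ⟨a * t + a * (p 0 + p 1 + p 2) / 3, ?_, ?_⟩
      · rw [Function.iterate_succ_apply']
        exact hτ.apply_param hc hN hf hmp ha hk _ _ ht
      · rw [pow_succ]
        linear_combination a * hte
  obtain ⟨t, ht, hte⟩ := hiter (n j - 1)
  rw [hxp, hp] at ht
  rw [param_injective M ht]
  exact hte

theorem HasMultiplier.exists_normalForm (hc : IsCuspidalCubic c) (h : f.HasMultiplier c a) :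
    ∃ M, HasNormalForm c M ∧ ∃ b, f.ActsBy c M a b := by
  obtain ⟨M, hM, hb⟩ := h
  exact ⟨M, hM.hasNormalForm hc.1 hc.2.1.ne_zero, hb⟩

/-- One more application of the affine map turns the exponent `n j - 1` into `n j`, and `a p = r + 2
b` replaces the points of indeterminacy of `f` by those of the inverse. -/
theorem orbit_relations (hn : ∀ j, 1 ≤ n j) {p r : Fin 3 → ℂ}
    (hr : ∀ j, r j = a * p j - 2 * (a * (p 0 + p 1 + p 2) / 3))
    (hp : ∀ j, (1 - a) * p (σ j) = a ^ (n j - 1) * ((1 - a) * r j) +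
        a * (p 0 + p 1 + p 2) / 3 * (1 - a ^ (n j - 1))) (j : Fin 3) :
    (1 - a) * r (σ j) - a * (p 0 + p 1 + p 2) / 3 =
      a ^ n j * ((1 - a) * r j - a * (p 0 + p 1 + p 2) / 3) +
        (a - 1) * (a * (p 0 + p 1 + p 2)) := by
  have h : a ^ n j = a * a ^ (n j - 1) := by rw [← pow_succ', Nat.sub_add_cancel (hn j)]
  rw [h, hr (σ j)]
  linear_combination a * hp j

/-- The eigenvector has `h = a (p 0 + p 1 + p 2)`, three times the translation part of the
restriction. It is nonzero because the parameters do not sum to 0, even when `a = 1`. -/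
theorem TentativelyRealizes.aeval_charPoly_eq_zero (hc : IsCuspidalCubic c) (hn : ∀ j, 1 ≤ n j)
    (h : f.TentativelyRealizes c n σ pPlus pMinus) (hmul : f.HasMultiplier c a) :
    Polynomial.aeval a (charPoly n σ) = 0 := by
  obtain ⟨M, hN, b, hact⟩ := hmul.exists_normalForm hc
  obtain ⟨a', k, p, r, ha, hk, hm, -, -, hr, hp⟩ := h.exists_coordinates hc.1 hN
  obtain ⟨rfl, -⟩ := hact.eq_model hc.1 hN h.properlyFixes hm ha hk
  rw [aeval_charPoly_eq_zero_iff hn]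
  refine ⟨a * (p 0 + p 1 + p 2), fun j => (1 - a) * r j - a * (p 0 + p 1 + p 2) / 3,
    Or.inl (mul_ne_zero ha hm.sum_ne_zero), ?_, orbit_relations hn hr hp⟩
  beta_reduce
  rw [hr 0, hr 1, hr 2]
  ring

theorem TentativelyRealizes.exists_hasMultiplier (hc : IsCuspidalCubic c)
    (h : f.TentativelyRealizes c n σ pPlus pMinus) : ∃ a, f.HasMultiplier c a := by
  obtain ⟨M, hN⟩ := hc.exists_normalForm
  obtain ⟨τ, hτ, -⟩ := h.orbits
  obtain ⟨a, k, u, -, -, -, hact⟩ := exists_model hc.1 hN h.properlyFixes hτ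
  exact ⟨a, M, hN.isAdapted hc.1, _, τ, hτ, hact⟩

/-- The fixed point has coordinate `b / (1 - a)`, which is nonzero; scaling by three times this
number moves it to `1/3`. -/
theorem TentativelyRealizes.exists_normalized (hc : IsCuspidalCubic c)
    (h : f.TentativelyRealizes c n σ pPlus pMinus) (hmul : f.HasMultiplier c a) (ha1 : a ≠ 1) :
    ∃ M, HasNormalForm c M ∧ f.ActsBy c M a ((1 - a) / 3) := by
  obtain ⟨M, hN, b, hact⟩ := hmul.exists_normalForm hc
  obtain ⟨a', k, p, r, ha, hk, hm, -, -, -, -⟩ := h.exists_coordinates hc.1 hN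
  obtain ⟨rfl, hb⟩ := hact.eq_model hc.1 hN h.properlyFixes hm ha hk
  have hb0 : b ≠ 0 := by
    rw [hb]
    exact div_ne_zero (mul_ne_zero ha hm.sum_ne_zero) (by norm_num)
  have h1a : 1 - a ≠ 0 := sub_ne_zero.2 ha1.symm
  have hs : 3 * b / (1 - a) ≠ 0 := div_ne_zero (mul_ne_zero (by norm_num) hb0) h1a
  refine ⟨_, hN.scale hs, ?_⟩
  obtain ⟨τ, hτ, hact⟩ := hact
  refine ⟨τ, hτ, fun q t hq => ?_⟩
  rw [param_scale] at hq ⊢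
  rw [hact q _ hq]
  congr 1
  field_simp

/-- The normalization forces `h = 1 - a`, so `eq_baseValue` determines the images `r j`. The
parameters of the model are then recovered from `r j = a p j - 2 b`. -/
theorem TentativelyRealizes.exists_normalized_model (hc : IsCuspidalCubic c) (hn : ∀ j, 1 ≤ n j)
    (h : f.TentativelyRealizes c n σ pPlus pMinus) (ha : ∀ m : ℕ, 0 < m → a ^ m ≠ 1)
    (hN : HasNormalForm c M) (hact : f.ActsBy c M a ((1 - a) / 3)) :
    (∀ j, pMinus j = param M (1 / 3 + baseValue n σ a j)) ∧ ∃ k, k ≠ 0 ∧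
      f.HasModel M a k (fun j => (1 / 3 + baseValue n σ a j + 2 * ((1 - a) / 3)) / a) := by
  obtain ⟨a', k, p, r, ha0, hk, hm, -, hpm, hr, hp⟩ := h.exists_coordinates hc.1 hN
  obtain ⟨rfl, hb⟩ := hact.eq_model hc.1 hN h.properlyFixes hm ha0 hk
  have h1a : 1 - a ≠ 0 := sub_ne_zero.2 fun h => ha 1 one_pos (by rw [pow_one, h])
  have hbase : ∀ j, r j = 1 / 3 + baseValue n σ a j := by
    intro j
    have := eq_baseValue (x := fun j => (1 - a) * r j - a * (p 0 + p 1 + p 2) / 3) ha hn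
      (orbit_relations hn hr hp) j
    beta_reduce at this
    refine mul_left_cancel₀ h1a ?_
    linear_combination this - (1 + 3 * baseValue n σ a j) * hb
  refine ⟨fun j => by rw [hpm, hbase], k, hk, ?_⟩
  convert hm using 1
  ext j
  rw [← hbase, hr, ← hb]
  field_simp
  ring

theorem HasModel.conjugateBy {g : QuadraticTransformation} {M' : Vec ≃ₗ[ℂ] Vec}
    (hf : f.HasModel M a k u) (hg : g.HasModel M' a k' u) (hk : k ≠ 0) (hk' : k' ≠ 0)
    (hN : HasNormalForm c M) (hN' : HasNormalForm c M') :
    f.ConjugateBy g c (M.symm.trans M') := by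
  refine ⟨hN.act_image_curve hN', k' / k, div_ne_zero hk' hk, fun v => ?_⟩
  have h1 := hf (M.symm v)
  have h2 := hg (M.symm v)
  rw [M.apply_symm_apply] at h1
  rw [LinearEquiv.trans_apply, LinearEquiv.trans_apply, h2, h1, map_smul, map_smul,
    M.symm_apply_apply, smul_smul, div_mul_cancel₀ _ hk]

end QuadraticTransformation

/-! ### The model as a quadratic transformation -/

/-- When the parameters do not sum to 0, this puts the equation of the cubic in the ideal of the
model's forms, so all base points of the model lie on the cubic. -/
theorem sum_mul_stdCubic (u : Fin 3 → ℂ) (v : Vec) :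
    (u 0 + u 1 + u 2) * stdCubic v = v 2 * evalTriple (modelTriple u) v 0 -
      (v 0 + v 2 * ((u 0 + u 1 + u 2) / 3)) * evalTriple (modelTriple u) v 2 := by
  simp [evalTriple, modelTriple, eval_conicForm, stdCubic]
  ring

theorem modelTriple_isHomogeneous (u : Fin 3 → ℂ) (i : Fin 3) :
    (modelTriple u i).IsHomogeneous 2 := by
  have h : ∀ q, (conicForm q).IsHomogeneous 2 := by
    intro q
    have hX : ∀ i, (X i : Poly).IsHomogeneous 1 := isHomogeneous_X ℂ
    refine (((((IsHomogeneous.C_mul ?_ _).add (IsHomogeneous.C_mul ?_ _)).add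
      (IsHomogeneous.C_mul ?_ _)).add (IsHomogeneous.C_mul ?_ _)).add
      (IsHomogeneous.C_mul ?_ _)).add (IsHomogeneous.C_mul ?_ _)
    · exact (hX 0).pow 2
    · exact (hX 0).mul (hX 1)
    · exact (hX 0).mul (hX 2)
    · exact (hX 1).pow 2
    · exact (hX 1).mul (hX 2)
    · exact (hX 2).pow 2
  fin_cases i <;> exact h _

theorem evalTriple_modelTriple_single (u : Fin 3 → ℂ) :
    evalTriple (modelTriple u) (Pi.single 1 1) = Pi.single 1 1 :=
  vec_ext (by simp [evalTriple, modelTriple, eval_conicForm])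
    (by simp [evalTriple, modelTriple, eval_conicForm])
    (by simp [evalTriple, modelTriple, eval_conicForm])

theorem exists_of_modelTriple_eq_zero {u : Fin 3 → ℂ} (hσ : u 0 + u 1 + u 2 ≠ 0) {v : Vec}
    (hv : v ≠ 0) (h : evalTriple (modelTriple u) v = 0) :
    v 2 ≠ 0 ∧ ∃ j, v = v 2 • cuspVec (u j) := by
  have hs : stdCubic v = 0 := by
    have := sum_mul_stdCubic u v
    rw [h] at this
    simpa [hσ] using this
  rcases stdCubic_eq_zero_cases hs with ⟨s, t, rfl⟩ | h1
  · have hs0 : s ≠ 0 := by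
      rintro rfl
      simp at hv
    rw [evalTriple_smul (modelTriple_isHomogeneous u), evalTriple_modelTriple_cuspVec, smul_smul,
      smul_eq_zero_iff_left (cuspVec_ne_zero _)] at h
    simp only [mul_eq_zero, pow_eq_zero_iff two_ne_zero, hs0, false_or, sub_eq_zero] at h
    refine ⟨by simpa using hs0, ?_⟩
    rcases h with (h | h) | h
    · exact ⟨0, by simp [← h]⟩
    · exact ⟨1, by simp [← h]⟩
    · exact ⟨2, by simp [← h]⟩
  · rw [h1, evalTriple_smul (modelTriple_isHomogeneous u), evalTriple_modelTriple_single] at h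
    have h2 : v 1 = 0 := by simpa using congrFun h 1
    rw [h2, zero_smul] at h1
    exact absurd h1 hv

/-- A common divisor can vanish only at multiples of the three base vectors or at the origin. It has
no zero on an affine line through the cusp vector `e` that avoids these, so it is constant there.
Such lines fill the complement of three planes, so the divisor is a constant polynomial. -/
theorem modelTriple_prim {u : Fin 3 → ℂ} (hσ : u 0 + u 1 + u 2 ≠ 0) (d : Poly)
    (hd : ∀ i, d ∣ modelTriple u i) : IsUnit d := by
  set e : Vec := Pi.single 1 1 with he
  have key : ∀ q : Vec, (∀ j, q 0 ≠ u j * q 2) → eval (e + q) d = eval e d := by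
    intro q hq
    let g : Fin 3 → Polynomial ℂ := fun i => Polynomial.C (e i) + Polynomial.X * Polynomial.C (q i)
    have hg : ∀ p t, (aeval g p).eval t = eval (e + t • q) p := by
      intro p t
      rw [eval_aeval_polynomial]
      congr 2
      funext i
      simp [g]
      ring
    have hroot : ∀ t, (aeval g d).eval t ≠ 0 := by
      intro t ht
      rw [hg] at ht
      have h0 : evalTriple (modelTriple u) (e + t • q) = 0 := by
        funext i
        obtain ⟨r, hr⟩ := hd i
        rw [evalTriple, hr, map_mul, ht, zero_mul]
        rfl
      have hv0 : (e + t • q) 0 = t * q 0 := by simp [he]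
      have hv1 : (e + t • q) 1 = 1 + t * q 1 := by simp [he]
      have hv2 : (e + t • q) 2 = t * q 2 := by simp [he]
      by_cases hv : e + t • q = 0
      · rw [hv] at hv0 hv1 hv2
        have ht0 : t ≠ 0 := by
          rintro rfl
          simp at hv1
        simp [ht0] at hv0 hv2
        exact hq 0 (by simp [hv0, hv2])
      · obtain ⟨h2, j, hj⟩ := exists_of_modelTriple_eq_zero hσ hv h0
        have hj0 := congrFun hj 0
        rw [hv0, Pi.smul_apply, cuspVec_zero, hv2, smul_eq_mul] at hj0
        rw [hv2] at h2
        have ht0 : t ≠ 0 := left_ne_zero_of_mul h2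
        refine hq j (mul_left_cancel₀ ht0 ?_)
        rw [hj0]
        ring
    have hconst : (aeval g d).natDegree = 0 := by
      by_contra hne
      obtain ⟨t, ht⟩ := IsAlgClosed.exists_root (aeval g d)
        (fun h => hne (Polynomial.natDegree_eq_zero_iff_degree_le_zero.2 h.le))
      exact hroot t ht
    have h0 := hg d 0
    have h1 := hg d 1
    rw [Polynomial.eq_C_of_natDegree_eq_zero hconst, Polynomial.eval_C] at h0 h1
    rw [one_smul] at h1
    rw [zero_smul, add_zero] at h0
    rw [← h1, h0]
  -- The product vanishes everywhere: its second factor is zero on the three exceptional planes, and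
  -- the first is zero off them.
  have hprod : (d - C (eval e d)) *
      ((X 0 - C (u 0) * X 2) * (X 0 - C (u 1) * X 2) * (X 0 - C (u 2) * X 2)) = 0 := by
    refine MvPolynomial.funext fun v => ?_
    by_cases hv : ∀ j, v 0 ≠ u j * v 2
    · have := key (v - e) (by simpa [he] using hv)
      rw [add_sub_cancel] at this
      simp [this]
    · push Not at hv
      obtain ⟨j, hj⟩ := hv
      fin_cases j <;> simp at hj <;> simp [hj]
  have hne : ((X 0 - C (u 0) * X 2) * (X 0 - C (u 1) * X 2) * (X 0 - C (u 2) * X 2) : Poly) ≠ 0 := by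
    intro h
    have := congrArg (eval (Pi.single 0 1 : Vec)) h
    simp at this
  have hdC := sub_eq_zero.1 ((mul_eq_zero.1 hprod).resolve_right hne)
  rw [hdC]
  refine (isUnit_iff_ne_zero.2 ?_).map C
  intro h0
  obtain ⟨r, hr⟩ := hd 1
  have h1 := congrFun (evalTriple_modelTriple_single u) 1
  rw [evalTriple, hr, map_mul, h0] at h1
  simp at h1

/-- The linear form vanishing at the points with parameters `x` and `y`. -/
noncomputable def lineDual (x y : ℂ) : Module.Dual ℂ Vec :=
  LinearMap.proj 1 - (x ^ 2 + x * y + y ^ 2) • LinearMap.proj 0 +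
    (x * y * (x + y)) • LinearMap.proj 2

theorem lineDual_apply (x y : ℂ) (v : Vec) :
    lineDual x y v = v 1 - (x ^ 2 + x * y + y ^ 2) * v 0 + x * y * (x + y) * v 2 := rfl

/-- The parameters of the points of indeterminacy of the inverse of the model. -/
noncomputable def invParam (u : Fin 3 → ℂ) : Fin 3 → ℂ := fun j => u j - 2 * ((u 0 + u 1 + u 2) / 3)

theorem sum_invParam (u : Fin 3 → ℂ) :
    invParam u 0 + invParam u 1 + invParam u 2 = -(u 0 + u 1 + u 2) := by
  simp only [invParam]
  ring

theorem invParam_invParam (u : Fin 3 → ℂ) : invParam (invParam u) = u := by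
  funext j
  rw [invParam, sum_invParam, invParam]
  ring

theorem modelTriple_inverse (u : Fin 3 → ℂ) (v : Vec) :
    evalTriple (modelTriple (invParam u)) (evalTriple (modelTriple u) v) =
      (lineDual (u 0) (u 1) v * lineDual (u 0) (u 2) v * lineDual (u 1) (u 2) v) • v := by
  refine vec_ext ?_ ?_ ?_ <;>
  · simp only [evalTriple, modelTriple, eval_conicForm, lineDual_apply, invParam, Matrix.cons_val,
      Matrix.cons_val_zero, Matrix.cons_val_one, Pi.smul_apply, smul_eq_mul]
    ring

theorem modelTriple_bind (u : Fin 3 → ℂ) : ∃ e : Poly, e ≠ 0 ∧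
    ∀ i, bind₁ (modelTriple u) (modelTriple (invParam u) i) = e * X i := by
  let l : ℂ → ℂ → Poly := fun x y =>
    X 1 - C (x ^ 2 + x * y + y ^ 2) * X 0 + C (x * y * (x + y)) * X 2
  have hl : ∀ x y v, eval v (l x y) = lineDual x y v := by
    intro x y v
    simp [l, lineDual_apply]
  refine ⟨l (u 0) (u 1) * l (u 0) (u 2) * l (u 1) (u 2), ?_, fun i => ?_⟩
  · intro h
    have := congrArg (eval (Pi.single 1 1 : Vec)) h
    simp only [map_mul, hl, lineDual_apply] at this
    simp at this
  · refine MvPolynomial.funext fun v => ?_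
    rw [eval_bind₁_triple, map_mul, map_mul, map_mul, hl, hl, hl, eval_X]
    exact congrFun (modelTriple_inverse u v) i

/-! ### Quadratic transformations built from the model. -/

namespace QuadraticTransformation

/-- The model quadratic transformation. -/
noncomputable def model (u : Fin 3 → ℂ) (hσ : u 0 + u 1 + u 2 ≠ 0) : QuadraticTransformation where
  fwd := modelTriple u
  bwd := modelTriple (invParam u)
  fwd_hom := modelTriple_isHomogeneous u
  bwd_hom := modelTriple_isHomogeneous _
  fwd_prim := modelTriple_prim hσ
  bwd_prim := modelTriple_prim (by rw [sum_invParam]; exact neg_ne_zero.2 hσ)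
  bwd_fwd := modelTriple_bind u
  fwd_bwd := by
    have := modelTriple_bind (invParam u)
    rwa [invParam_invParam] at this

theorem conjTriple_prim {F : Fin 3 → Poly} (hF : ∀ d : Poly, (∀ i, d ∣ F i) → IsUnit d)
    (A B : Vec ≃ₗ[ℂ] Vec) (d : Poly)
    (hd : ∀ i, d ∣ conjTriple A.toLinearMap F B.toLinearMap i) : IsUnit d := by
  have h1 : conjTriple A.symm.toLinearMap (conjTriple A.toLinearMap F B.toLinearMap)
      B.symm.toLinearMap = F := by
    refine triple_ext fun v => ?_
    rw [evalTriple_conjTriple, evalTriple_conjTriple]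
    simp
  have h2 := hF (bind₁ (linTriple B.symm.toLinearMap) d) fun i => by
    rw [← congrFun h1 i]
    exact dvd_conjTriple hd i
  rw [← bind₁_linTriple_symm B d]
  exact h2.map _

theorem conjTriple_bind {F G : Fin 3 → Poly}
    (h : ∃ e : Poly, e ≠ 0 ∧ ∀ i, bind₁ F (G i) = e * X i) (A B : Vec ≃ₗ[ℂ] Vec) :
    ∃ e : Poly, e ≠ 0 ∧ ∀ i, bind₁ (conjTriple A.toLinearMap F B.toLinearMap)
      (conjTriple B.symm.toLinearMap G A.symm.toLinearMap i) = e * X i := by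
  obtain ⟨e, he, h⟩ := h
  refine ⟨bind₁ (linTriple B.toLinearMap) e, fun h0 => he ?_, fun i => ?_⟩
  · have := bind₁_linTriple_symm B.symm e
    rw [LinearEquiv.symm_symm, h0, map_zero] at this
    exact this.symm
  · refine MvPolynomial.funext fun v => ?_
    have h1 : evalTriple G (evalTriple F (B v)) = eval (B v) e • B v := by
      ext j
      have := congrArg (eval (B v)) (h j)
      rw [eval_bind₁_triple, map_mul, eval_X] at this
      exact this
    rw [eval_bind₁_triple, evalTriple_conjTriple, map_mul, eval_bind₁_triple,
      evalTriple_linTriple, eval_X]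
    change evalTriple _ _ i = _
    rw [evalTriple_conjTriple]
    simp [h1]

/-- The composition `A ∘ f ∘ B` of a quadratic transformation with linear automorphisms. -/
noncomputable def linConj (f : QuadraticTransformation) (A B : Vec ≃ₗ[ℂ] Vec) :
    QuadraticTransformation where
  fwd := conjTriple A.toLinearMap f.fwd B.toLinearMap
  bwd := conjTriple B.symm.toLinearMap f.bwd A.symm.toLinearMap
  fwd_hom := conjTriple_isHomogeneous _ f.fwd_hom _
  bwd_hom := conjTriple_isHomogeneous _ f.bwd_hom _
  fwd_prim := conjTriple_prim f.fwd_prim A B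
  bwd_prim := conjTriple_prim f.bwd_prim B.symm A.symm
  bwd_fwd := conjTriple_bind f.bwd_fwd A B
  fwd_bwd := conjTriple_bind f.fwd_bwd B.symm A.symm

end QuadraticTransformation

/-- The third intersection of the line with the curve has parameter `-u j - u m`. Adding a third of
the sum of all parameters gives `invParam u i`, and the whole line is sent to that point. -/
theorem evalTriple_modelTriple_of_line {u : Fin 3 → ℂ} {i j m : Fin 3} (hij : i ≠ j) (hjm : j ≠ m)
    (him : i ≠ m) {v : Vec} (hv : lineDual (u j) (u m) v = 0) :
    evalTriple (modelTriple u) v =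
      evalTriple (modelTriple u) v 2 • cuspVec (invParam u i) := by
  have hu : modelTriple u = modelTriple ![u i, u j, u m] :=
    modelTriple_congr_of_ne hij hjm him (by decide : (0 : Fin 3) ≠ 1) (by decide : (1 : Fin 3) ≠ 2)
      (by decide) rfl rfl rfl
  rw [hu, invParam, sum_eq_of_ne hij hjm him]
  generalize u i = x at *
  generalize u j = y at *
  generalize u m = z at *
  have h1 : v 1 = (y ^ 2 + y * z + z ^ 2) * v 0 - y * z * (y + z) * v 2 := by
    rw [lineDual_apply] at hv
    linear_combination hv
  refine vec_ext ?_ ?_ ?_ <;>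
  · simp [evalTriple, modelTriple, eval_conicForm, h1]
    try ring

theorem lineDual_cuspVec (x y t : ℂ) :
    lineDual x y (cuspVec t) = (t - x) * (t - y) * (t + x + y) := by
  rw [lineDual_apply, cuspVec_zero, cuspVec_one, cuspVec_two]
  ring

theorem eq_smul_rep_param (M : Vec ≃ₗ[ℂ] Vec) (t : ℂ) :
    ∃ s : ℂ, M (cuspVec t) = s • (param M t).rep := by
  obtain ⟨s, hs, e⟩ := exists_rep_param M t
  exact ⟨s⁻¹, by rw [e, smul_smul, inv_mul_cancel₀ hs, one_smul]⟩

theorem scaling_eq_zero_iff {a : ℂ} (ha : a ≠ 0) (v : Vec) : scaling a v = 0 ↔ v = 0 := by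
  rw [← scalingEquiv_apply a ha, LinearEquiv.map_eq_zero_iff]

/-! ### Existence of a realization. -/

namespace QuadraticTransformation

variable {f : QuadraticTransformation} {c : Poly} {M : Vec ≃ₗ[ℂ] Vec} {a k : ℂ}
  {u : Fin 3 → ℂ}

/-- `HasModel` constrains only the forward forms, so the points of indeterminacy of the inverse are
recorded separately. -/
theorem exists_hasModel (M : Vec ≃ₗ[ℂ] Vec) (ha : a ≠ 0) (hσ : u 0 + u 1 + u 2 ≠ 0) :
    ∃ f : QuadraticTransformation, f.HasModel M a 1 u ∧
      f.indetInv = Set.range fun j => param M (a * invParam u j) := by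
  have hσ' : invParam u 0 + invParam u 1 + invParam u 2 ≠ 0 := by
    rw [sum_invParam]
    exact neg_ne_zero.2 hσ
  set S := (scalingEquiv a ha).trans M with hS
  refine ⟨(model u hσ).linConj S M.symm, fun v => ?_, ?_⟩
  · change evalTriple (conjTriple S.toLinearMap (modelTriple u) M.symm.toLinearMap) _ = _
    rw [evalTriple_conjTriple, one_smul]
    simp [hS, scalingEquiv_apply]
  · have hbwd : ∀ v, evalTriple ((model u hσ).linConj S M.symm).bwd v =
        M (evalTriple (modelTriple (invParam u)) (S.symm v)) :=
      evalTriple_conjTriple M.toLinearMap (modelTriple (invParam u)) S.symm.toLinearMap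
    have hcusp : ∀ t, M (cuspVec (a * t)) = S (cuspVec t) := fun t => by
      rw [← scaling_cuspVec]
      rfl
    ext p
    rw [indetInv, Set.mem_ofPred_eq, hbwd, M.map_eq_zero_iff]
    constructor
    · intro h
      obtain ⟨-, j, hj⟩ := exists_of_modelTriple_eq_zero hσ'
        (fun h => p.rep_nonzero (S.symm.map_eq_zero_iff.1 h)) h
      refine ⟨j, (eq_param_of_rep (s := S.symm p.rep 2) ?_).symm⟩
      rw [hcusp, ← map_smul, ← hj, S.apply_symm_apply]
    · rintro ⟨j, rfl⟩
      obtain ⟨s, -, e⟩ := exists_rep_param M (a * invParam u j)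
      rw [e, hcusp, map_smul, S.symm_apply_apply,
        evalTriple_smul (modelTriple_isHomogeneous _), evalTriple_modelTriple_cuspVec]
      fin_cases j <;> simp

namespace HasModel

theorem indet_eq (h : f.HasModel M a k u) (ha : a ≠ 0) (hk : k ≠ 0) :
    f.indet = Set.range fun j => param M (u j) := by
  ext p
  constructor
  · intro hp
    have h1 := h (M.symm p.rep)
    rw [M.apply_symm_apply, show evalTriple f.fwd p.rep = 0 from hp, eq_comm,
      smul_eq_zero_iff_right hk, M.map_eq_zero_iff, scaling_eq_zero_iff ha] at h1
    obtain ⟨-, j, hj⟩ := exists_of_modelTriple_eq_zero h.sum_ne_zero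
      (fun h => p.rep_nonzero (M.symm.map_eq_zero_iff.1 h)) h1
    refine ⟨j, (eq_param_of_rep (s := M.symm p.rep 2) ?_).symm⟩
    rw [← map_smul, ← hj, M.apply_symm_apply]
  · rintro ⟨j, rfl⟩
    exact (h.param_mem_indet hk _).2 ⟨j, rfl⟩

theorem contracts (h : f.HasModel M a k u) {i j m : Fin 3} (hij : i ≠ j) (hjm : j ≠ m)
    (him : i ≠ m) : f.Contracts (lineDual (u j) (u m) ∘ₗ M.symm.toLinearMap)
      (param M (a * invParam u i)) := by
  constructor
  · intro h0
    have := LinearMap.congr_fun h0 (M (Pi.single 1 1))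
    simp [lineDual_apply] at this
  · intro v hv
    have h1 := h (M.symm v)
    change lineDual (u j) (u m) (M.symm v) = 0 at hv
    rw [M.apply_symm_apply, evalTriple_modelTriple_of_line hij hjm him hv, map_smul, map_smul,
      scaling_cuspVec] at h1
    obtain ⟨s, hs⟩ := eq_smul_rep_param M (a * invParam u i)
    rw [hs, smul_smul, smul_smul] at h1
    exact ⟨_, h1⟩

theorem lineDual_param_eq_zero_iff (x y t : ℂ) :
    (lineDual x y ∘ₗ M.symm.toLinearMap) (param M t).rep = 0 ↔
      (t - x) * (t - y) * (t + x + y) = 0 := by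
  rw [apply_rep_param_eq_zero_iff]
  simp [lineDual_cuspVec]

/-- The lines `lineDual` through pairs of parameters serve in all three cases; when two parameters
coincide, the line becomes the tangent at that point. -/
theorem isIndexing (h : f.HasModel M a k u) (ha : a ≠ 0) (hk : k ≠ 0)
    (hinv : f.indetInv = Set.range fun j => param M (a * invParam u j)) :
    f.IsIndexing (fun j => param M (u j)) (fun j => param M (a * invParam u j)) := by
  refine ⟨h.indet_eq ha hk, hinv, ?_⟩
  have hinvc : ∀ {i j}, u i = u j → invParam u i = invParam u j := fun hij => by
    rw [invParam, invParam, hij]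
  by_cases hinj : Function.Injective u
  · left
    refine ⟨(param_injective M).comp hinj, fun x => ?_⟩
    obtain ⟨j, m, hxj, hjm, hxm⟩ : ∃ j m, x ≠ j ∧ j ≠ m ∧ x ≠ m := by
      decide +revert
    refine ⟨_, fun y hy => ?_, h.contracts hxj hjm hxm⟩
    rw [lineDual_param_eq_zero_iff]
    rcases fin_three_eq hxj hjm hxm y with rfl | rfl | rfl
    · exact absurd rfl hy
    · ring
    · ring
  · right
    obtain ⟨i, j, huij, hij⟩ : ∃ i j, u i = u j ∧ i ≠ j := by
      simpa [Function.Injective] using hinj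
    obtain ⟨m, hjm, him⟩ : ∃ m, j ≠ m ∧ i ≠ m := by
      clear huij
      decide +revert
    by_cases huim : u i = u m
    · right
      have hall : ∀ x, u x = u i := by
        intro x
        rcases fin_three_eq hij hjm him x with rfl | rfl | rfl
        · rfl
        · exact huij.symm
        · exact huim.symm
      refine ⟨fun x y => congrArg (param M) ((hall x).trans (hall y).symm),
        fun x y => congrArg (fun t => param M (a * t)) (hinvc ((hall x).trans (hall y).symm)), _, ?_,
        h.contracts (by decide : (0 : Fin 3) ≠ 1) (by decide : (1 : Fin 3) ≠ 2) (by decide)⟩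
      rw [lineDual_param_eq_zero_iff, hall 0, hall 1]
      ring
    · left
      -- The line through `u i` and `u m` goes to the point with index `j`, and the tangent at `u i
      -- = u j` to the one with index `m`. The tangent misses `u m` because the three parameters do
      -- not sum to 0.
      refine ⟨i, j, m, hij, hjm, him, congrArg (param M) huij, (param_injective M).ne huim,
        congrArg (fun t => param M (a * t)) (hinvc huij), ⟨_, ?_, ?_, h.contracts hij.symm him hjm⟩,
        ⟨_, ?_, ?_, h.contracts him.symm hij hjm.symm⟩⟩
      · rw [lineDual_param_eq_zero_iff]
        ring
      · rw [lineDual_param_eq_zero_iff]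
        ring
      · rw [lineDual_param_eq_zero_iff]
        ring
      · rw [Ne, lineDual_param_eq_zero_iff]
        have hs := h.sum_ne_zero
        rw [sum_eq_of_ne him.symm hij hjm.symm] at hs
        have hne : u m - u i ≠ 0 := sub_ne_zero.2 (Ne.symm huim)
        exact mul_ne_zero (mul_ne_zero hne (huij ▸ hne)) hs

theorem fwd_param (h : f.HasModel M a k u) (t : ℂ) :
    evalTriple f.fwd (M (cuspVec t)) = (k * ((t - u 0) * (t - u 1) * (t - u 2))) •
      M (cuspVec (a * t + a * (u 0 + u 1 + u 2) / 3)) := by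
  rw [h, evalTriple_modelTriple_cuspVec, map_smul, map_smul, scaling_cuspVec, smul_smul]
  congr 3
  ring

theorem maps_param (h : f.HasModel M a k u) {t : ℂ} (ht : param M t ∉ f.indet) :
    f.Maps (param M t) (param M (a * t + a * (u 0 + u 1 + u 2) / 3)) := by
  refine ⟨ht, ?_⟩
  obtain ⟨s, -, e⟩ := exists_rep_param M t
  obtain ⟨s', e'⟩ := eq_smul_rep_param M (a * t + a * (u 0 + u 1 + u 2) / 3)
  rw [e, evalTriple_smul f.fwd_hom, h.fwd_param, e', smul_smul, smul_smul]
  exact ⟨_, rfl⟩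

/-- The cusp is fixed and `t` goes to `a t + b`, so the image lies on the curve and misses at most
the images of the three parameters `u j`. A form vanishing on the image restricts to a polynomial in
`t` with infinitely many zeros, so these points lie in the closure. -/
theorem properlyFixes (hc : c.IsHomogeneous 3) (hN : HasNormalForm c M)
    (h : f.HasModel M a k u) (ha : a ≠ 0) (hk : k ≠ 0)
    (hinv : f.indetInv = Set.range fun j => param M (a * invParam u j)) :
    f.ProperlyFixes c := by
  have hreg : ∀ t, param M t ∈ regPts c := fun t => by
    rw [← hN.isAdapted hc]
    exact ⟨t, rfl⟩
  refine ⟨Set.Subset.antisymm (fun p hp => ?_) (fun p hp d g hg hvan => ?_), ?_, ?_⟩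
  · refine hp 3 c hc ?_
    rintro q ⟨p, hp, hpi, s, hs⟩
    change q ∈ curve c
    have hs0 : s ≠ 0 := by
      rintro rfl
      rw [zero_smul] at hs
      exact hpi hs
    rw [hN.mem_curve] at hp ⊢
    have hfwd : stdCubic (M.symm (evalTriple f.fwd p.rep)) = 0 := by
      have h1 := h (M.symm p.rep)
      rw [M.apply_symm_apply] at h1
      rw [h1, map_smul, M.symm_apply_apply, stdCubic_smul]
      rcases stdCubic_eq_zero_cases hp with ⟨s, t, e⟩ | e
      · rw [e, evalTriple_smul (modelTriple_isHomogeneous u), evalTriple_modelTriple_cuspVec,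
          smul_smul, map_smul, scaling_cuspVec, stdCubic_smul, stdCubic_cuspVec]
        simp
      · rw [e, evalTriple_smul (modelTriple_isHomogeneous u), evalTriple_modelTriple_single]
        simp [stdCubic]
    rw [hs, map_smul, stdCubic_smul] at hfwd
    simpa [hs0] using hfwd
  · have hp' := (hN.mem_curve p).1 hp
    rcases stdCubic_eq_zero_cases hp' with ⟨s, t, e⟩ | e
    · let H : Polynomial ℂ := curveRestrict (bind₁ (linTriple M.toLinearMap) g)
      have hH : ∀ t, H.eval t = eval (M (cuspVec t)) g := fun t => by
        rw [eval_curveRestrict, eval_bind₁_triple, evalTriple_linTriple]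
        rfl
      have hz : H.comp (Polynomial.C a * Polynomial.X +
          Polynomial.C (a * (u 0 + u 1 + u 2) / 3)) = 0 := by
        refine (mul_eq_zero.1 (?_ : _ * ((Polynomial.X - Polynomial.C (u 0)) *
          (Polynomial.X - Polynomial.C (u 1)) * (Polynomial.X - Polynomial.C (u 2))) = 0)).resolve_right
          (mul_ne_zero (mul_ne_zero (Polynomial.X_sub_C_ne_zero _) (Polynomial.X_sub_C_ne_zero _))
            (Polynomial.X_sub_C_ne_zero _))
        refine Polynomial.funext fun t => ?_
        by_cases ht : param M t ∈ f.indet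
        · obtain ⟨j, rfl⟩ := (h.param_mem_indet hk t).1 ht
          fin_cases j <;> simp
        · have h1 := hvan _ ⟨_, (hreg t).1, h.maps_param ht⟩
          obtain ⟨s, hs, e⟩ := exists_rep_param M (a * t + a * (u 0 + u 1 + u 2) / 3)
          rw [e, eval_smul_form hg, mul_eq_zero_iff_left (pow_ne_zero d hs), ← hH] at h1
          rw [Polynomial.eval_mul, Polynomial.eval_comp]
          simp [h1]
      have hHt : H.eval t = 0 := by
        have := congrArg (Polynomial.eval ((t - a * (u 0 + u 1 + u 2) / 3) / a)) hz
        rw [Polynomial.eval_comp] at this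
        simpa [mul_div_cancel₀ _ ha] using this
      rw [hH] at hHt
      have e' : p.rep = s • M (cuspVec t) := by rw [← map_smul, ← e, M.apply_symm_apply]
      rw [e', eval_smul_form hg, hHt, mul_zero]
    · obtain ⟨y, e'⟩ : ∃ y : ℂ, p.rep = y • M (Pi.single 1 1) :=
        ⟨_, by rw [← map_smul, ← e, M.apply_symm_apply]⟩
      have hfwd : evalTriple f.fwd p.rep = (y * k * a ^ 3) • p.rep := by
        rw [e']
        have hsc : scaling a (Pi.single 1 1) = a ^ 3 • Pi.single 1 1 :=
          vec_ext (by simp) (by simp) (by simp)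
        rw [evalTriple_smul f.fwd_hom, h, evalTriple_modelTriple_single, hsc, map_smul, smul_smul,
          smul_smul, smul_smul]
        congr 1
        ring
      refine hvan p ⟨p, hp, ?_, _, hfwd⟩
      have hne : y ≠ 0 := by
        rintro rfl
        rw [zero_smul] at e'
        exact p.rep_nonzero e'
      rw [indet, Set.mem_ofPred_eq, hfwd]
      exact smul_ne_zero (mul_ne_zero (mul_ne_zero hne hk) (pow_ne_zero 3 ha)) p.rep_nonzero
  · intro p _ hp
    rw [h.indet_eq ha hk] at hp
    obtain ⟨j, rfl⟩ := hp
    exact hreg _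
  · intro p _ hp
    rw [hinv] at hp
    obtain ⟨j, rfl⟩ := hp
    exact hreg _

/-- The quadratic forms vanish at the points of indeterminacy on the curve. The affine map is
regular there because it is also given by cubic forms without zeros on the smooth part. -/
theorem exists_isRestriction (hc : c.IsHomogeneous 3) (hN : HasNormalForm c M)
    (h : f.HasModel M a k u) : ∃ τ, f.IsRestriction c τ ∧
      ∀ (p : regPts c) (t : ℂ), (p : P2) = param M t →
        (τ p : P2) = param M (a * t + a * (u 0 + u 1 + u 2) / 3) := by
  have hreg : ∀ t, param M t ∈ regPts c := fun t => by
    rw [← hN.isAdapted hc]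
    exact ⟨t, rfl⟩
  choose κ hκ using fun p : regPts c => (hN.isAdapted hc).ge p.2
  set b := a * (u 0 + u 1 + u 2) / 3 with hb
  let τ : regPts c → regPts c := fun p => ⟨param M (a * κ p + b), hreg _⟩
  have hτ : ∀ (p : regPts c) (t : ℂ), (p : P2) = param M t → (τ p : P2) = param M (a * t + b) := by
    intro p t hp
    rw [← hκ] at hp
    rw [← param_injective M hp]
  refine ⟨τ, ⟨fun p hp => ?_, fun p => ?_⟩, hτ⟩
  · rw [hτ p _ (hκ p).symm]
    have := h.maps_param (t := κ p) (by rwa [hκ])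
    rwa [hκ] at this
  · let L : Poly := C a * X 0 + C b * X 2
    have hX : ∀ i, (X i : Poly).IsHomogeneous 1 := isHomogeneous_X ℂ
    have hL : L.IsHomogeneous 1 := ((hX 0).C_mul a).add ((hX 2).C_mul b)
    -- These forms take `(t, t³, 1)` to `(a t + b, (a t + b)³, 1)` with no extra factor.
    let A : Fin 3 → Poly := ![L * X 2 ^ 2, L ^ 3, X 2 ^ 3]
    have hA : ∀ i, (A i).IsHomogeneous 3 := by
      intro i
      fin_cases i
      · exact hL.mul ((hX 2).pow 2)
      · exact hL.pow 3
      · exact (hX 2).pow 3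
    have hB := conjTriple_isHomogeneous M.toLinearMap hA M.symm.toLinearMap
    have hBt : ∀ t, evalTriple (conjTriple M.toLinearMap A M.symm.toLinearMap) (M (cuspVec t)) =
        M (cuspVec (a * t + b)) := by
      intro t
      rw [evalTriple_conjTriple]
      simp only [LinearEquiv.coe_coe, M.symm_apply_apply]
      congr 1
      exact vec_ext (by simp [evalTriple, A, L]) (by simp [evalTriple, A, L])
        (by simp [evalTriple, A])
    refine ⟨3, _, hB, ?_, fun q _ => ?_⟩
    · rw [← hκ, Ne, evalTriple_param_eq_zero_iff hB, hBt, M.map_eq_zero_iff]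
      exact cuspVec_ne_zero _
    · obtain ⟨s, -, e⟩ := exists_rep_param M (κ q)
      obtain ⟨s', e'⟩ := eq_smul_rep_param M (a * κ q + b)
      rw [hτ q _ (hκ q).symm, ← hκ q, e, evalTriple_smul hB, hBt, e', smul_smul]
      exact ⟨_, rfl⟩

end HasModel

/-- The eigenvector is scaled to `h = 1`, and its coordinates become the displacements `y j` of the
points of indeterminacy of the inverse from the fixed point `1/3`. Solving `1/3 + y j = a u j - 2 (1
- a) / 3` gives the parameters of the model. -/
theorem exists_tentativelyRealizes {n : Fin 3 → ℕ} {σ : Equiv.Perm (Fin 3)}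
    (hc : IsCuspidalCubic c) (hn : ∀ j, 1 ≤ n j)
    (hroot : Polynomial.aeval a (charPoly n σ) = 0) (ha : ∀ m : ℕ, 0 < m → a ^ m ≠ 1) :
    ∃ (f : QuadraticTransformation) (pPlus pMinus : Fin 3 → P2),
      f.TentativelyRealizes c n σ pPlus pMinus ∧ f.HasMultiplier c a := by
  obtain ⟨h, x, hne, hsum, hx⟩ := (aeval_charPoly_eq_zero_iff hn a).1 hroot
  -- For `h = 0` the recursion is homogeneous and has only the zero solution, since `a` is not a
  -- root of unity.
  have hh : h ≠ 0 := by
    rintro rfl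
    refine hne.elim (fun h => h rfl) fun hx0 => hx0 (funext fun j => ?_)
    rw [eq_baseValue ha hn hx, mul_zero]
    rfl
  -- Zero is not a root of unity and needs its own argument: the recursion would give `x j = -h` for
  -- all `j`, so the sum relation would read `-3 h = -2 h`.
  have ha0 : a ≠ 0 := by
    rintro rfl
    have hxj : ∀ j, x j = -h := by
      intro j
      have := hx (σ.symm j)
      rw [σ.apply_symm_apply, zero_pow (by have := hn (σ.symm j); omega)] at this
      rw [this]
      ring
    rw [hxj, hxj, hxj] at hsum
    exact hh (by linear_combination -hsum)
  have ha1 : 1 - a ≠ 0 := sub_ne_zero.2 fun h => ha 1 one_pos (by rw [pow_one, h])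
  set y : Fin 3 → ℂ := fun j => x j / h with hy
  have hysum : y 0 + y 1 + y 2 = a - 2 := by
    rw [hy]
    field_simp
    linear_combination hsum
  have hyσ : ∀ j, y (σ j) = a ^ n j * y j + (a - 1) := by
    intro j
    simp only [hy]
    rw [hx]
    field_simp
  set u : Fin 3 → ℂ := fun j => (1 / 3 + y j + 2 * ((1 - a) / 3)) / a with hu
  -- The sum relation of the eigenvector is exactly what makes the translation part of the model
  -- equal to `(1 - a) / 3`, so that `1/3` is indeed the fixed point.
  have husum : a * (u 0 + u 1 + u 2) = 1 - a := by
    simp only [hu]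
    field_simp
    linear_combination 3 * hysum
  have hσ : u 0 + u 1 + u 2 ≠ 0 := by
    intro h0
    rw [h0, mul_zero] at husum
    exact ha1 husum.symm
  have hr : ∀ j, a * invParam u j = 1 / 3 + y j := by
    intro j
    have : a * u j = 1 / 3 + y j + 2 * ((1 - a) / 3) := by
      simp only [hu]
      field_simp
    rw [invParam]
    linear_combination this - 2 / 3 * husum
  obtain ⟨M, hN⟩ := hc.exists_normalForm
  obtain ⟨f, hm, hinv⟩ := exists_hasModel M ha0 hσ
  obtain ⟨τ, hτ, hact⟩ := hm.exists_isRestriction hc.1 hN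
  refine ⟨f, _, _, ⟨hm.properlyFixes hc.1 hN ha0 one_ne_zero hinv,
    hm.isIndexing ha0 one_ne_zero hinv, τ, hτ, fun j => ?_⟩,
    ⟨M, hN.isAdapted hc.1, _, τ, hτ, hact⟩⟩
  have hreg : ∀ t, param M t ∈ regPts c := fun t => by
    rw [← hN.isAdapted hc.1]
    exact ⟨t, rfl⟩
  have hiter : ∀ m : ℕ, (τ^[m] ⟨_, hreg (a * invParam u j)⟩ : P2) =
      param M (1 / 3 + a ^ m * y j) := by
    intro m
    induction m with
    | zero =>
      rw [pow_zero, one_mul, ← hr]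
      rfl
    | succ m ih =>
      rw [Function.iterate_succ_apply', hact _ _ ih, husum]
      congr 1
      rw [pow_succ]
      ring
  refine ⟨⟨_, hreg _⟩, rfl, ?_⟩
  rw [hiter]
  congr 1
  simp only [hu]
  rw [hyσ, ← Nat.sub_add_cancel (hn j), pow_succ]
  field_simp
  simp
  ring

end QuadraticTransformation

end CuspCubic

theorem mainTheorem5 (c : CuspCubic.Poly) (hc : CuspCubic.IsCuspidalCubic c)
    (n : Fin 3 → ℕ) (hn : ∀ j, 1 ≤ n j) (σ : Equiv.Perm (Fin 3)) :
    -- a multiplier of a tentative realization is a root of the characteristic polynomial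
    (∀ (f : CuspCubic.QuadraticTransformation) (pPlus pMinus : Fin 3 → CuspCubic.P2),
      f.TentativelyRealizes c n σ pPlus pMinus →
        (∃ a, f.HasMultiplier c a) ∧
        ∀ a, f.HasMultiplier c a → Polynomial.aeval a (CuspCubic.charPoly n σ) = 0) ∧
    -- conversely, for each root that is not a root of unity:
    (∀ a : ℂ, Polynomial.aeval a (CuspCubic.charPoly n σ) = 0 →
      (∀ m : ℕ, 0 < m → a ^ m ≠ 1) →
        -- existence
        (∃ (f : CuspCubic.QuadraticTransformation) (pPlus pMinus : Fin 3 → CuspCubic.P2),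
          f.TentativelyRealizes c n σ pPlus pMinus ∧ f.HasMultiplier c a) ∧
        -- uniqueness up to linear conjugacy
        (∀ (f g : CuspCubic.QuadraticTransformation)
          (pPlus pMinus qPlus qMinus : Fin 3 → CuspCubic.P2),
          f.TentativelyRealizes c n σ pPlus pMinus → f.HasMultiplier c a →
          g.TentativelyRealizes c n σ qPlus qMinus → g.HasMultiplier c a →
            ∃ T, f.ConjugateBy g c T) ∧
        -- the coordinate can be chosen such that the fixed point is `1/3`, and then the points
        -- of indeterminacy of the inverse are given by explicit formulas
        (∀ (f : CuspCubic.QuadraticTransformation) (pPlus pMinus : Fin 3 → CuspCubic.P2),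
          f.TentativelyRealizes c n σ pPlus pMinus → f.HasMultiplier c a →
            (∃ M, CuspCubic.IsAdapted c M ∧ f.ActsBy c M a ((1 - a) / 3)) ∧
            ∀ M, CuspCubic.IsAdapted c M → f.ActsBy c M a ((1 - a) / 3) →
              ∀ j, pMinus j = CuspCubic.param M (1 / 3 + CuspCubic.baseValue n σ a j))) := by
  refine ⟨fun f pPlus pMinus hf => ⟨hf.exists_hasMultiplier hc, fun a ha =>
    hf.aeval_charPoly_eq_zero hc hn ha⟩, fun a hroot ha => ?_⟩
  have ha1 : a ≠ 1 := fun h => ha 1 one_pos (by rw [pow_one, h])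
  refine ⟨CuspCubic.QuadraticTransformation.exists_tentativelyRealizes hc hn hroot ha, ?_, ?_⟩
  · intro f g pPlus pMinus qPlus qMinus hf hfa hg hga
    obtain ⟨M, hN, hact⟩ := hf.exists_normalized hc hfa ha1
    obtain ⟨M', hN', hact'⟩ := hg.exists_normalized hc hga ha1
    obtain ⟨-, k, hk, hm⟩ := hf.exists_normalized_model hc hn ha hN hact
    obtain ⟨-, k', hk', hm'⟩ := hg.exists_normalized_model hc hn ha hN' hact'
    exact ⟨_, hm.conjugateBy hm' hk hk' hN hN'⟩
  · intro f pPlus pMinus hf hfa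
    refine ⟨?_, fun M hM hact => ?_⟩
    · obtain ⟨M, hN, hact⟩ := hf.exists_normalized hc hfa ha1
      exact ⟨M, hN.isAdapted hc.1, hact⟩
    · exact (hf.exists_normalized_model hc hn ha
        (hM.hasNormalForm hc.1 hc.2.1.ne_zero) hact).1
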